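/- Consider $k$ identical units and $n$ unit-demand agents with valuation profile $v=(v_1,\dots,v_n)\in[0,\infty)^n$ (with $n,k\ge 0$ integers). **Optimal mechanisms and benchmark.** Let $F$ be a distribution on $[0,\infty)$ with finite mean whose support is a closed interval (bounded or unbounded above) and which has a density $f$ that is positive on this interval. Put $\vartheta(z)=\frac{1-F(z)}{f(z)}$, $H(x)=\int_0^x\vartheta(F^{-1}(r))\,dr$ for $x\in[0,1]$, let $\hat H$ be the largest convex function on $[0,1]$ with $\hat H\le H$, let $g$ be the right derivative of $\hat H$ on $[0,1)$ and $g(1)$ the left derivative of $\hat H$ at $1$, and let $\bar\vartheta(z)=g(F(z))$ (the ironed virtual valuation for utility). The mechanism $\mathrm{Mye}_F$ picks the set $W$ of winners uniformly at random among the sets of $\min(k,n)$ agents that maximize $\sum_{i\in W}\bar\vartheta(v_i)$ over all sets of at most $k$ agents. If $x_i(v)$ is the probability that $i$ wins and $\pi_i(v)=v_ix_i(v)-\int_0^{v_i}x_i(z,v_{-i})\,dz$, then a winner $i$ is charged $\pi_i(v)/x_i(v)$ and a loser is charged $0$. The residual surplus of an outcome is the expected sum over winners of valuation minus payment; $\mathrm{Mye}_F(v)$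 also denotes the residual surplus of $\mathrm{Mye}_F$ on $v$. Let $\mathcal G(v)=\sup_F\mathrm{Mye}_F(v)$. **Lotteries.** For $p\ge 0$, the $k$-unit $p$-lottery serves the agents with value at least $p$ at price $p$; if there are more than $k$ of them, $k$ of them are chosen uniformly at random. Its residual surplus is $L_p(v)$. For $0\le q\le p$, let $S$ be the set of agents with value in $(p,\infty)$, $T$ the set of agents with value in $(q,p]$, $s=|S|$, $t=|T|$. The $k$-unit $(p,q)$-lottery is the following: (1) if $s>k$, $k$ uniformly random agents of $S$ win at price $p$; (2) if $s+t\le k$, all agents of $S\cup T$ win at price $q$; (3) otherwise each agent of $S$ wins at price $\frac{k-s+1}{t+1}q+\frac{s+t-k}{t+1}p$, and $k-s$ uniformly random agents of $T$ win at price $q$. Its residual surplus is $L_{p,q}(v)$. **Claim.** For every $n$, $k$ and $v$: (a) For every $F$ as above there are $0\le q\le p$ such that $\mathrm{Mye}_F$ on $v$ has the same random set of winners, and the same prices for the agents who can win, as the $k$-unit $(p,q)$-lottery on $v$, where agents whose value is exactly $p$ or exactly $q$ may have to be put on the other side of that threshold (agents with equal values being treated alike). (b) $\mathcal G(v)$ is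 finite, and there are $0\le q\le p$ with $L_{p,q}(v)=\mathcal G(v)$. (c) For all $0\le q\le p$: $L_{p,q}(v)\le L_{p,p}(v)+L_{q,q}(v)$, where $L_{p,p}(v)$ and $L_{q,q}(v)$ are the residual surpluses of the single-price lotteries restricted to the agents with value strictly above the price. In particular $L_{p,q}(v)\le L_p(v)+L_q(v)$ if no agent has value exactly $p$ or $q$. In all cases there is $p'\ge 0$ with $L_{p'}(v)\ge\frac12 L_{p,q}(v)$. (d) There is $p\ge 0$ such that the $k$-unit $p$-lottery has residual surplus $L_p(v)\ge\mathcal G(v)/2$. -/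

import Mathlib

namespace MoneyBurning

noncomputable section

/-! ### The common prior and its ironed virtual valuation for utility -/

/-- A distribution of a nonnegative valuation with finite mean whose support is a closed interval,
bounded (`[a, b]`) or not (`[a, ∞)`), with positive density throughout this interval. -/
structure Prior where
  density : ℝ → ℝ
  support : Set ℝ
  isClosed_support : IsClosed support
  ordConnected_support : support.OrdConnected
  support_nonneg : ∀ z ∈ support, 0 ≤ z
  measurable_density : Measurable density
  density_pos : ∀ z ∈ support, 0 < density z
  density_eq_zero : ∀ z, z ∉ support → density z = 0
  integrable_density : MeasureTheory.Integrable density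
  integral_density : ∫ z, density z = 1
  integrable_mean : MeasureTheory.Integrable (fun z => z * density z)

namespace Prior

/-- The cumulative distribution function `F`. -/
def cdf (D : Prior) (z : ℝ) : ℝ := ∫ t in Set.Iic z, D.density t

/-- The inverse `F⁻¹` of the distribution function; on `(0, 1)` it is the inverse of the strictly
increasing continuous function `F` restricted to the support. -/
def quantile (D : Prior) (q : ℝ) : ℝ := sInf {z | z ∈ D.support ∧ q ≤ D.cdf z}

/-- The virtual valuation for utility, `(1 - F(z)) / f(z)`. -/
def virtualValue (D : Prior) (z : ℝ) : ℝ := (1 - D.cdf z) / D.density z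

/-- `H(q) = ∫₀^q h(r) dr` with `h(r) = ϑ(F⁻¹(r))`. -/
def cumulative (D : Prior) (q : ℝ) : ℝ := ∫ r in (0 : ℝ)..q, D.virtualValue (D.quantile r)

/-- The convex hull of `H`: the largest convex function on `[0, 1]` bounded above by `H`, as the
pointwise supremum of all convex functions bounded above by `H`. -/
def hull (D : Prior) (q : ℝ) : ℝ :=
  sSup {y | ∃ φ : ℝ → ℝ, ConvexOn ℝ (Set.Icc 0 1) φ ∧
    (∀ r ∈ Set.Icc (0 : ℝ) 1, φ r ≤ D.cumulative r) ∧ y = φ q}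

/-- The right-continuous derivative of the convex hull on `[0, 1)`, i.e. its right derivative;
at the right end point `1` it is the left derivative. -/
def hullSlope (D : Prior) (q : ℝ) : ℝ :=
  if q < 1 then derivWithin D.hull (Set.Icc q 1) q else derivWithin D.hull (Set.Icc 0 1) 1

/-- The ironed virtual valuation for utility. -/
def ironedValue (D : Prior) (z : ℝ) : ℝ := D.hullSlope (D.cdf z)

end Prior

/-! ### Outcomes of randomized mechanisms on a fixed valuation profile -/

/-- The probability that agent `i` wins when the set of winners is drawn uniformly at random
from the family `𝒲`. -/
def winProb {n : ℕ} (𝒲 : Finset (Finset (Fin n))) (i : Fin n) : ℝ :=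
  ((𝒲.filter (fun W => i ∈ W)).card : ℝ) / (𝒲.card : ℝ)

/-- A randomized outcome: the set of winners is drawn uniformly at random from `winners`, every
winner `i` is charged `price i`, and losers are charged nothing. -/
structure Outcome (n : ℕ) where
  winners : Finset (Finset (Fin n))
  price : Fin n → ℝ

/-- The expected residual surplus: the expectation of the sum, over the winners, of valuation
minus (burnt) payment. -/
def Outcome.surplus {n : ℕ} (o : Outcome n) (v : Fin n → ℝ) : ℝ :=
  (∑ W ∈ o.winners, ∑ i ∈ W, (v i - o.price i)) / (o.winners.card : ℝ)

/-- Two outcomes coincide: the random set of winners has the same law, and every agent who can win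
is charged the same price on winning. -/
def Outcome.Same {n : ℕ} (o o' : Outcome n) : Prop :=
  o.winners = o'.winners ∧ ∀ W ∈ o.winners, ∀ i ∈ W, o.price i = o'.price i

/-! ### The Bayesian optimal mechanism and the benchmark -/

open Classical in
/-- The winner sets in a `k`-unit auction among which the mechanism optimal for `D` randomizes
uniformly: all units are awarded (to the extent that there are agents), and the ironed virtual
surplus is maximum among all feasible allocations. -/
def myeWinners {n : ℕ} (D : Prior) (k : ℕ) (v : Fin n → ℝ) : Finset (Finset (Fin n)) :=
  Finset.univ.filter fun W => W.card = min k n ∧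
    ∀ W' : Finset (Fin n), W'.card ≤ k →
      ∑ i ∈ W', D.ironedValue (v i) ≤ ∑ i ∈ W, D.ironedValue (v i)

/-- The allocation rule: the probability that agent `i` wins on the profile `v`. -/
def myeAlloc {n : ℕ} (D : Prior) (k : ℕ) (v : Fin n → ℝ) (i : Fin n) : ℝ :=
  winProb (myeWinners D k v) i

/-- The expected payment given by the payment identity
`pᵢ(v) = vᵢ xᵢ(v) - ∫₀^{vᵢ} xᵢ(z, v₋ᵢ) dz`. -/
def myePayment {n : ℕ} (D : Prior) (k : ℕ) (v : Fin n → ℝ) (i : Fin n) : ℝ :=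
  v i * myeAlloc D k v i - ∫ z in (0 : ℝ)..v i, myeAlloc D k (Function.update v i z) i

/-- The symmetric optimal mechanism for `D`, run on the profile `v`. Winner `i` is charged
`pᵢ(v) / xᵢ(v)`. -/
def mye {n : ℕ} (D : Prior) (k : ℕ) (v : Fin n → ℝ) : Outcome n where
  winners := myeWinners D k v
  price i := myePayment D k v i / myeAlloc D k v i

/-- The benchmark: the supremum, over all priors, of the expected residual surplus of the
symmetric optimal mechanism for this prior on the profile `v`. -/
def benchmark {n : ℕ} (k : ℕ) (v : Fin n → ℝ) : ℝ :=
  ⨆ D : Prior, (mye D k v).surplus v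

/-! ### Lotteries -/

/-- The lottery of `m` units at price `p` among the agents in `A`: if there are more than `m` such
agents, `m` winners are selected uniformly at random, otherwise all of them win. -/
def lotteryOn {n : ℕ} (m : ℕ) (A : Finset (Fin n)) (p : ℝ) : Outcome n where
  winners := A.powersetCard (min m A.card)
  price _ := p

/-- The `k`-unit `p`-lottery, among the agents with value at least `p`. -/
def pLottery {n : ℕ} (k : ℕ) (p : ℝ) (v : Fin n → ℝ) : Outcome n :=
  lotteryOn k (Finset.univ.filter fun i => p ≤ v i) p

/-- The two-price lottery with priority agents `S` and second-class agents `T`.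
* If `S` has more than `k` agents, run a `k`-unit `p`-lottery on `S`.
* If `S ∪ T` has at most `k` agents, sell to all of them at price `q`.
* Otherwise each agent of `S` gets a unit at the incentive compatible price, and the remaining
  units are given by a lottery at price `q` among `T`. -/
def twoPriceOn {n : ℕ} (k : ℕ) (S T : Finset (Fin n)) (p q : ℝ) : Outcome n :=
  if k < S.card then lotteryOn k S p
  else if S.card + T.card ≤ k then { winners := {S ∪ T}, price := fun _ => q }
  else
    { winners := (lotteryOn (k - S.card) T q).winners.image (fun W => S ∪ W)
      price := fun i =>
        if i ∈ S then
          ((k : ℝ) - S.card + 1) / ((T.card : ℝ) + 1) * q +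
            ((S.card : ℝ) + T.card - k) / ((T.card : ℝ) + 1) * p
        else q }

/-- The `k`-unit `(p,q)`-lottery: the priority agents are those with value in `(p, ∞)`, the
second-class agents those with value in `(q, p]`. -/
def pqLottery {n : ℕ} (k : ℕ) (p q : ℝ) (v : Fin n → ℝ) : Outcome n :=
  twoPriceOn k (Finset.univ.filter fun i => p < v i)
    (Finset.univ.filter fun i => q < v i ∧ v i ≤ p) p q

/-- `S` and `T` are the two classes of agents for the thresholds `p` and `q`, up to the treatment
of agents whose value equals a threshold, who may be put on either side of it (agents with equal
values being treated alike). If no value equals `p` or `q`, then `S` is the set of agents with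
value in `(p, ∞)` and `T` the set of those with value in `(q, p]`. -/
structure IsSplit {n : ℕ} (v : Fin n → ℝ) (p q : ℝ) (S T : Finset (Fin n)) : Prop where
  disjoint : Disjoint S T
  mem_of_gt_p : ∀ i, p < v i → i ∈ S
  ge_p_of_mem : ∀ i ∈ S, p ≤ v i
  mem_of_gt_q : ∀ i, q < v i → i ∈ S ∪ T
  ge_q_of_mem : ∀ i ∈ S ∪ T, q ≤ v i
  symm : ∀ i j, v i = v j → ((i ∈ S ↔ j ∈ S) ∧ (i ∈ T ↔ j ∈ T))

end

end MoneyBurning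

namespace MoneyBurning

noncomputable section

/-! ### Winning probabilities -/

/-! For (a), the ironed virtual value is nonnegative and monotone. If `k < n`, a cutoff `d` splits
the agents into those above `d`, who always win, and those at `d`, who share the remaining units. As
a function of one bid the allocation is thus a step function whose steps lie at two thresholds `q ≤
p`, and the payment identity yields the lottery prices (`exists_mye_same`). If `n ≤ k`, everybody
wins for free.

For the other parts, `splitSurplus` expresses all three cases of a two-price lottery by one formula.
Ties at the thresholds are resolved in the best way by the `(p,q)`-lottery
(`IsSplit.splitSurplus_le`), so the benchmark lies between `0` and the maximum of `pqSurplus`, which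
is attained at thresholds among `0` and the values. When a threshold rises, the surplus is
right-continuous and jumps only upwards, and it ends at `0` once both thresholds exceed all values;
so every number between `0` and the maximum is attained, in particular the benchmark
(`exists_pqSurplus_eq`).

The comparison with single prices is termwise: the priority term is the `p`-lottery, and the rebates
and the `T` term are dominated by the `q`-lottery (`pqSurplus_add_le`). The slack in this estimate
pays for moving a price off a tie, which gives the factor `1/2`. -/

theorem Outcome.surplus_eq_sum_winProb {n : ℕ} (o : Outcome n) (v : Fin n → ℝ) :
    o.surplus v = ∑ i, winProb o.winners i * (v i - o.price i) := by
  have h : ∑ W ∈ o.winners, ∑ i ∈ W, (v i - o.price i)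
      = ∑ i, ((o.winners.filter (fun W => i ∈ W)).card : ℝ) * (v i - o.price i) := by
    calc ∑ W ∈ o.winners, ∑ i ∈ W, (v i - o.price i)
        = ∑ W ∈ o.winners, ∑ i, if i ∈ W then v i - o.price i else 0 := by
          refine Finset.sum_congr rfl fun W _ => ?_
          rw [Finset.sum_ite_mem, Finset.univ_inter]
      _ = ∑ i, ∑ W ∈ o.winners, if i ∈ W then v i - o.price i else 0 := Finset.sum_comm
      _ = _ := by
          refine Finset.sum_congr rfl fun i _ => ?_
          rw [← Finset.sum_filter, Finset.sum_const, nsmul_eq_mul]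
  rw [Outcome.surplus, h, Finset.sum_div]
  refine Finset.sum_congr rfl fun i _ => ?_
  rw [winProb]
  ring

theorem Outcome.Same.surplus_eq {n : ℕ} {o o' : Outcome n} (h : o.Same o') (v : Fin n → ℝ) :
    o.surplus v = o'.surplus v := by
  rw [Outcome.surplus, Outcome.surplus, ← h.1]
  congr 1
  refine Finset.sum_congr rfl fun W hW => Finset.sum_congr rfl fun i hi => ?_
  rw [h.2 W hW i hi]

theorem winProb_powersetCard {n m : ℕ} {A : Finset (Fin n)} (hm : m ≤ A.card) {i : Fin n}
    (hi : i ∈ A) : winProb (A.powersetCard m) i = (m : ℝ) / A.card := by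
  have hA : 0 < A.card := Finset.card_pos.2 ⟨i, hi⟩
  rcases Nat.eq_zero_or_pos m with rfl | hm0
  · simp [winProb, Finset.filter_singleton]
  have hc : ((A.powersetCard m).filter fun W => i ∈ W).card
      = (A.card - 1).choose (m - 1) := by
    have := Finset.card_filter_powersetCard_subset {i} A m
      (by simpa using hi) (by rw [Finset.card_singleton]; exact hm0)
    simpa using this
  rw [winProb, hc, Finset.card_powersetCard]
  obtain ⟨a, ha⟩ : ∃ a, A.card = a + 1 := ⟨A.card - 1, by omega⟩
  obtain ⟨l, rfl⟩ : ∃ l, m = l + 1 := ⟨m - 1, by omega⟩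
  rw [ha] at hm ⊢
  have h := Nat.add_one_mul_choose_eq a l
  have hpos : 0 < (a + 1).choose (l + 1) := Nat.choose_pos hm
  simp only [Nat.add_sub_cancel]
  rw [div_eq_div_iff (by positivity) (by positivity)]
  have h' : ((a + 1 : ℕ) : ℝ) * (a.choose l : ℝ)
      = ((a + 1).choose (l + 1) : ℝ) * ((l + 1 : ℕ) : ℝ) := by exact_mod_cast h
  linarith

theorem winProb_eq_zero {n : ℕ} {𝒲 : Finset (Finset (Fin n))} {i : Fin n}
    (h : ∀ W ∈ 𝒲, i ∉ W) : winProb 𝒲 i = 0 := by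
  rw [winProb, Finset.filter_false_of_mem h]
  simp

theorem winProb_eq_one {n : ℕ} {𝒲 : Finset (Finset (Fin n))} {i : Fin n} (hne : 𝒲.Nonempty)
    (h : ∀ W ∈ 𝒲, i ∈ W) : winProb 𝒲 i = 1 := by
  rw [winProb, Finset.filter_true_of_mem h, div_self]
  exact_mod_cast (Finset.card_pos.2 hne).ne'

/-- The winner sets that contain all of `S` and `m` agents of `T`. -/
def priorityWinners {n : ℕ} (m : ℕ) (S T : Finset (Fin n)) : Finset (Finset (Fin n)) :=
  (T.powersetCard m).image fun W => S ∪ W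

theorem priorityWinners_nonempty {n m : ℕ} {S T : Finset (Fin n)} (hm : m ≤ T.card) :
    (priorityWinners m S T).Nonempty :=
  (Finset.powersetCard_nonempty.2 hm).image _

theorem winProb_priorityWinners_of_mem_left {n m : ℕ} {S T : Finset (Fin n)} (hm : m ≤ T.card)
    {i : Fin n} (hi : i ∈ S) : winProb (priorityWinners m S T) i = 1 := by
  refine winProb_eq_one (priorityWinners_nonempty hm) fun W hW => ?_
  obtain ⟨U, -, rfl⟩ := Finset.mem_image.1 hW
  exact Finset.mem_union_left _ hi

theorem winProb_priorityWinners_of_mem_right {n m : ℕ} {S T : Finset (Fin n)}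
    (hST : Disjoint S T) (hm : m ≤ T.card) {i : Fin n} (hi : i ∈ T) :
    winProb (priorityWinners m S T) i = (m : ℝ) / T.card := by
  -- Since `S` and `T` are disjoint, adding `S` is injective on subsets of `T`, so the uniform law
  -- on the image is that of the lottery on `T`.
  have hinj : Set.InjOn (fun W => S ∪ W) (T.powersetCard m : Set (Finset (Fin n))) := by
    intro U hU U' hU' h
    have hd : ∀ {U : Finset (Fin n)}, U ∈ T.powersetCard m → (S ∪ U) \ S = U := fun hU =>
      Finset.union_sdiff_cancel_left (hST.mono_right (Finset.mem_powersetCard.1 hU).1)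
    rw [← hd hU, ← hd hU']
    exact congrArg (· \ S) h
  have hiS : i ∉ S := fun h => Finset.disjoint_left.1 hST h hi
  rw [← winProb_powersetCard hm hi, winProb, winProb, priorityWinners, Finset.filter_image,
    Finset.card_image_of_injOn hinj, Finset.card_image_of_injOn]
  · congr 3
    ext W
    simp [hiS]
  · exact hinj.mono (by simp [Set.subset_def]; tauto)

theorem winProb_priorityWinners_of_notMem {n m : ℕ} {S T : Finset (Fin n)} {i : Fin n}
    (hS : i ∉ S) (hT : i ∉ T) : winProb (priorityWinners m S T) i = 0 := by
  refine winProb_eq_zero fun W hW hi => ?_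
  obtain ⟨U, hU, rfl⟩ := Finset.mem_image.1 hW
  rcases Finset.mem_union.1 hi with h | h
  · exact hS h
  · exact hT ((Finset.mem_powersetCard.1 hU).1 h)

/-! ### The residual surplus of a two-price lottery -/

/-- The probability of obtaining one of `m` units allocated at random among `a` agents. -/
def rate (m a : ℕ) : ℝ := (m : ℝ) / max (m : ℝ) a

theorem rate_nonneg (m a : ℕ) : 0 ≤ rate m a := by
  unfold rate
  positivity

theorem rate_zero_left (a : ℕ) : rate 0 a = 0 := by simp [rate]

theorem rate_of_le {m a : ℕ} (hm : 0 < m) (h : a ≤ m) : rate m a = 1 := by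
  have : (a : ℝ) ≤ m := by exact_mod_cast h
  rw [rate, max_eq_left this, div_self]
  exact_mod_cast hm.ne'

theorem rate_of_ge {m a : ℕ} (h : m ≤ a) : rate m a = (m : ℝ) / a := by
  have : (m : ℝ) ≤ a := by exact_mod_cast h
  rw [rate, max_eq_right this]

/-- Adding the same amount to numerator and denominator of a fraction that is at most `1` does not
decrease it: `β` extra units outweigh `β` extra competitors. -/
theorem rate_le_rate_of_add {m a m' a' : ℕ} (β : ℕ) (hm : m + β ≤ m') (ha : a' ≤ a + β) :
    rate m a ≤ rate m' a' := by
  rcases Nat.eq_zero_or_pos m with rfl | hm0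
  · rw [rate_zero_left]
    exact rate_nonneg _ _
  have hmR : (0 : ℝ) < m := by exact_mod_cast hm0
  have h1 : (m : ℝ) + β ≤ m' := by exact_mod_cast hm
  have h2 : (a' : ℝ) ≤ a + β := by exact_mod_cast ha
  have hβ : (0 : ℝ) ≤ β := Nat.cast_nonneg β
  have hx1 : (m : ℝ) ≤ max (m : ℝ) a := le_max_left _ _
  have hx2 : (a : ℝ) ≤ max (m : ℝ) a := le_max_right _ _
  unfold rate
  rw [div_le_div_iff₀ (by positivity) (lt_max_of_lt_left (by linarith))]
  rw [mul_max_of_nonneg _ _ hmR.le]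
  refine max_le ?_ ?_
  · nlinarith
  · generalize max (m : ℝ) a = x at *
    nlinarith [mul_le_mul_of_nonneg_left h2 hmR.le, mul_le_mul_of_nonneg_left hx2 hmR.le,
      mul_le_mul_of_nonneg_left hx1 hβ, mul_le_mul_of_nonneg_right h1 (hmR.le.trans hx1)]

theorem rate_mono {m a m' a' : ℕ} (hm : m ≤ m') (ha : a' ≤ a) : rate m a ≤ rate m' a' :=
  rate_le_rate_of_add 0 hm ha

/-- The residual surplus of the two-price lottery: agents of `S` pay `p` for priority and get a
rebate `p - q` with the probability that they would have won as an agent of `T`. -/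
def splitSurplus {n : ℕ} (k : ℕ) (S T : Finset (Fin n)) (p q : ℝ) (v : Fin n → ℝ) : ℝ :=
  rate k S.card * ∑ i ∈ S, (v i - p) + S.card * rate (k + 1 - S.card) (T.card + 1) * (p - q) +
    rate (k - S.card) T.card * ∑ i ∈ T, (v i - q)

theorem lotteryOn_surplus {n : ℕ} (k : ℕ) (A : Finset (Fin n)) (p : ℝ) (v : Fin n → ℝ) :
    (lotteryOn k A p).surplus v = rate k A.card * ∑ i ∈ A, (v i - p) := by
  have hr : ∀ i ∈ A, winProb (A.powersetCard (min k A.card)) i = rate k A.card := by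
    intro i hi
    have hA : 0 < A.card := Finset.card_pos.2 ⟨i, hi⟩
    rw [winProb_powersetCard (min_le_right _ _) hi]
    rcases le_total k A.card with h | h
    · rw [min_eq_left h, rate_of_ge h]
    · rw [min_eq_right h, rate_of_le (hA.trans_le h) h, div_self (by positivity)]
  rw [Outcome.surplus_eq_sum_winProb, Finset.mul_sum,
    ← Finset.sum_subset (Finset.subset_univ A)]
  · exact Finset.sum_congr rfl fun i hi => by rw [← hr i hi]; rfl
  · intro i _ hi
    rw [winProb_eq_zero, zero_mul]
    exact fun W hW h => hi ((Finset.mem_powersetCard.1 hW).1 h)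

theorem twoPriceOn_of_le_of_lt {n k : ℕ} {S T : Finset (Fin n)} (p q : ℝ) (h1 : S.card ≤ k)
    (h2 : k < S.card + T.card) :
    twoPriceOn k S T p q =
    { winners := priorityWinners (k - S.card) S T
      price := fun i =>
        if i ∈ S then
          ((k : ℝ) - S.card + 1) / ((T.card : ℝ) + 1) * q +
            ((S.card : ℝ) + T.card - k) / ((T.card : ℝ) + 1) * p
        else q } := by
  rw [twoPriceOn, if_neg (by omega), if_neg (by omega)]
  simp only [lotteryOn, priorityWinners, min_eq_left (show k - S.card ≤ T.card by omega)]

theorem twoPriceOn_surplus {n : ℕ} (k : ℕ) {S T : Finset (Fin n)} (hST : Disjoint S T) (p q : ℝ)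
    (v : Fin n → ℝ) : (twoPriceOn k S T p q).surplus v = splitSurplus k S T p q v := by
  rcases lt_or_ge k S.card with h1 | h1
  -- With more than `k` priority agents both truncated differences are `0`, so the rebate and the
  -- `T` term vanish.
  · rw [twoPriceOn, if_pos h1, lotteryOn_surplus, splitSurplus,
      show k + 1 - S.card = 0 by omega, show k - S.card = 0 by omega]
    simp [rate_zero_left]
  have hx1 : rate k S.card * ∑ i ∈ S, (v i - p) = ∑ i ∈ S, (v i - p) := by
    rcases S.eq_empty_or_nonempty with rfl | hS
    · simp
    · rw [rate_of_le ((Finset.card_pos.2 hS).trans_le h1) h1, one_mul]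
  rcases le_or_gt (S.card + T.card) k with h2 | h2
  · have hT : rate (k - S.card) T.card * ∑ i ∈ T, (v i - q) = ∑ i ∈ T, (v i - q) := by
      rcases T.eq_empty_or_nonempty with rfl | hT
      · simp
      · have := Finset.card_pos.2 hT
        rw [rate_of_le (by omega) (by omega), one_mul]
    rw [twoPriceOn, if_neg (by omega), if_pos h2, splitSurplus, hT, hx1,
      rate_of_le (by omega) (by omega)]
    simp only [Outcome.surplus, Finset.sum_singleton, Finset.card_singleton, Nat.cast_one, div_one]
    rw [Finset.sum_union hST]
    simp only [Finset.sum_sub_distrib, Finset.sum_const, nsmul_eq_mul]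
    ring
  · have hm : k - S.card ≤ T.card := by omega
    rw [twoPriceOn_of_le_of_lt p q h1 h2, Outcome.surplus_eq_sum_winProb,
      ← Finset.sum_subset (Finset.subset_univ (S ∪ T)), Finset.sum_union hST]
    · rw [splitSurplus, hx1, rate_of_ge (show k - S.card ≤ T.card by omega),
        rate_of_ge (show k + 1 - S.card ≤ T.card + 1 by omega), Finset.mul_sum]
      congr 1
      · have hk : ((k + 1 - S.card : ℕ) : ℝ) = k - S.card + 1 := by
          rw [Nat.cast_sub (by omega)]
          push_cast
          ring
        have hc : (S.card : ℝ) * (((k : ℝ) - S.card + 1) / ((T.card : ℝ) + 1)) * (p - q)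
            = ∑ i ∈ S, (((k : ℝ) - S.card + 1) / ((T.card : ℝ) + 1)) * (p - q) := by
          rw [Finset.sum_const, nsmul_eq_mul]
          ring
        rw [hk, Nat.cast_add, Nat.cast_one, hc, ← Finset.sum_add_distrib]
        refine Finset.sum_congr rfl fun i hi => ?_
        rw [winProb_priorityWinners_of_mem_left hm hi]
        simp only [if_pos hi]
        field_simp
        ring
      · refine Finset.sum_congr rfl fun i hi => ?_
        have hiS : i ∉ S := fun h => Finset.disjoint_left.1 hST h hi
        rw [winProb_priorityWinners_of_mem_right hST hm hi]
        simp only [if_neg hiS]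
    · intro i _ hi
      rw [Finset.mem_union, not_or] at hi
      rw [winProb_priorityWinners_of_notMem hi.1 hi.2, zero_mul]

/-! ### Agents at a threshold -/

/-- An agent with value `p` contributes only a rebate while in `S`. Demoting `A` adds `A.card` units
and at most as many competitors to the lottery for `T`, so no chance of winning or of a rebate
decreases. -/
theorem splitSurplus_le_of_demote {n k : ℕ} {S T A : Finset (Fin n)} {p q : ℝ} {v : Fin n → ℝ}
    (hST : Disjoint S T) (hqp : q ≤ p) (hS : ∀ i ∈ S, p ≤ v i) (hT : ∀ i ∈ T, q ≤ v i)
    (hA : A ⊆ S) (hAp : ∀ i ∈ A, v i = p) :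
    splitSurplus k S T p q v ≤ splitSurplus k (S \ A) (T ∪ A) p q v := by
  rcases A.eq_empty_or_nonempty with rfl | hne
  · simp
  have hα : 0 < A.card := Finset.card_pos.2 hne
  have hAS : A.card ≤ S.card := Finset.card_le_card hA
  have hTA : Disjoint T A := (hST.mono_left hA).symm
  have hcS : (S \ A).card = S.card - A.card := Finset.card_sdiff_of_subset hA
  have hcT : (T ∪ A).card = T.card + A.card := Finset.card_union_of_disjoint hTA
  have hsS : ∑ i ∈ S, (v i - p) = ∑ i ∈ S \ A, (v i - p) := by
    rw [← Finset.sum_sdiff hA, Finset.sum_eq_zero (s := A), add_zero]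
    exact fun i hi => by rw [hAp i hi, sub_self]
  have hsT : ∑ i ∈ T ∪ A, (v i - q) = ∑ i ∈ T, (v i - q) + A.card * (p - q) := by
    rw [Finset.sum_union hTA, ← nsmul_eq_mul, ← Finset.sum_const]
    congr 1
    exact Finset.sum_congr rfl fun i hi => by rw [hAp i hi]
  have h0S : 0 ≤ ∑ i ∈ S \ A, (v i - p) :=
    Finset.sum_nonneg fun i hi => sub_nonneg.2 (hS i (Finset.mem_sdiff.1 hi).1)
  have h0T : 0 ≤ ∑ i ∈ T, (v i - q) := Finset.sum_nonneg fun i hi => sub_nonneg.2 (hT i hi)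
  have i1 : rate k S.card ≤ rate k (S.card - A.card) := rate_mono le_rfl (Nat.sub_le _ _)
  -- The alternative `m = 0` covers the truncated differences, for which `m + β ≤ m'` may fail when
  -- `S` exceeds the supply.
  have aux : ∀ m a m' a' β : ℕ, (m = 0 ∨ m + β ≤ m') → a' ≤ a + β → rate m a ≤ rate m' a' := by
    rintro m a m' a' β (rfl | h) h'
    · rw [rate_zero_left]
      exact rate_nonneg _ _
    · exact rate_le_rate_of_add β h h'
  have i2 : rate (k + 1 - S.card) (T.card + 1)
      ≤ rate (k + 1 - (S.card - A.card)) (T.card + A.card + 1) :=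
    aux _ _ _ _ A.card (by omega) (by omega)
  -- The rebate chance already counts the agent itself among the `T.card + 1` competitors, so only
  -- the other `A.card - 1` demoted agents are new.
  have i3 : rate (k + 1 - S.card) (T.card + 1) ≤ rate (k - (S.card - A.card)) (T.card + A.card) :=
    aux _ _ _ _ (A.card - 1) (by omega) (by omega)
  have i4 : rate (k - S.card) T.card ≤ rate (k - (S.card - A.card)) (T.card + A.card) :=
    aux _ _ _ _ A.card (by omega) (by omega)
  have hcs : (S.card : ℝ) = ((S.card - A.card : ℕ) : ℝ) + A.card := by
    rw [Nat.cast_sub hAS]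
    ring
  rw [splitSurplus, splitSurplus, hcS, hcT, hsS, hsT]
  rw [hcs]
  have hpq : 0 ≤ p - q := sub_nonneg.2 hqp
  have j1 := mul_le_mul_of_nonneg_right i1 h0S
  have j2 := mul_le_mul_of_nonneg_left i2
    (mul_nonneg (Nat.cast_nonneg (α := ℝ) (S.card - A.card)) hpq)
  have j3 := mul_le_mul_of_nonneg_left i3 (mul_nonneg (Nat.cast_nonneg (α := ℝ) A.card) hpq)
  have j4 := mul_le_mul_of_nonneg_right i4 h0T
  linarith

/-- Agents with value `q` contribute nothing, and their absence improves the odds of the rest of `T`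
and the rebates of `S`. -/
theorem splitSurplus_le_of_drop {n k : ℕ} {S T A : Finset (Fin n)} {p q : ℝ} {v : Fin n → ℝ}
    (hqp : q ≤ p) (hT : ∀ i ∈ T, q ≤ v i) (hA : A ⊆ T) (hAq : ∀ i ∈ A, v i = q) :
    splitSurplus k S T p q v ≤ splitSurplus k S (T \ A) p q v := by
  have hle : (T \ A).card ≤ T.card := Finset.card_le_card Finset.sdiff_subset
  have hsT : ∑ i ∈ T, (v i - q) = ∑ i ∈ T \ A, (v i - q) := by
    rw [← Finset.sum_sdiff hA, Finset.sum_eq_zero (s := A), add_zero]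
    exact fun i hi => by rw [hAq i hi, sub_self]
  have h0T : 0 ≤ ∑ i ∈ T \ A, (v i - q) :=
    Finset.sum_nonneg fun i hi => sub_nonneg.2 (hT i (Finset.mem_sdiff.1 hi).1)
  have hpq : 0 ≤ p - q := sub_nonneg.2 hqp
  rw [splitSurplus, splitSurplus, hsT]
  gcongr
  · exact rate_mono le_rfl (by omega)
  · exact rate_mono le_rfl hle

/-- The residual surplus of the `(p,q)`-lottery. -/
def pqSurplus {n : ℕ} (k : ℕ) (v : Fin n → ℝ) (p q : ℝ) : ℝ :=
  splitSurplus k (Finset.univ.filter fun i => p < v i)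
    (Finset.univ.filter fun i => q < v i ∧ v i ≤ p) p q v

theorem pqLottery_surplus {n : ℕ} (k : ℕ) (v : Fin n → ℝ) (p q : ℝ) :
    (pqLottery k p q v).surplus v = pqSurplus k v p q := by
  refine twoPriceOn_surplus k ?_ p q v
  rw [Finset.disjoint_left]
  intro i h1 h2
  simp only [Finset.mem_filter, Finset.mem_univ, true_and] at h1 h2
  exact absurd h1 h2.2.not_gt

/-- Strict thresholds are the best tie rule: ties at `p` are first demoted to `T`, then ties at `q`
are dropped. -/
theorem IsSplit.splitSurplus_le {n : ℕ} (k : ℕ) {v : Fin n → ℝ} {p q : ℝ} {S T : Finset (Fin n)}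
    (h : IsSplit v p q S T) (hqp : q ≤ p) : splitSurplus k S T p q v ≤ pqSurplus k v p q := by
  have hSp : S \ S.filter (fun i => v i = p) = Finset.univ.filter fun i => p < v i := by
    ext i
    simp only [Finset.mem_sdiff, Finset.mem_filter, Finset.mem_univ, true_and, not_and]
    constructor
    · rintro ⟨hi, hne⟩
      exact lt_of_le_of_ne (h.ge_p_of_mem i hi) (Ne.symm (hne hi))
    · exact fun hi => ⟨h.mem_of_gt_p i hi, fun _ => hi.ne'⟩
  have hT : ∀ i ∈ T ∪ S.filter (fun i => v i = p), q ≤ v i := by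
    intro i hi
    refine h.ge_q_of_mem i ?_
    rcases Finset.mem_union.1 hi with hi | hi
    · exact Finset.mem_union_right _ hi
    · exact Finset.mem_union_left _ (Finset.mem_filter.1 hi).1
  have hTq : (T ∪ S.filter fun i => v i = p) \
      (T ∪ S.filter fun i => v i = p).filter (fun i => v i = q)
      = Finset.univ.filter fun i => q < v i ∧ v i ≤ p := by
    ext i
    simp only [Finset.mem_sdiff, Finset.mem_filter, Finset.mem_univ, true_and]
    constructor
    · rintro ⟨hi, hne⟩
      refine ⟨lt_of_le_of_ne (hT i hi) fun he => hne ⟨hi, he.symm⟩, ?_⟩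
      rcases Finset.mem_union.1 hi with hi | hi
      · by_contra hlt
        exact Finset.disjoint_left.1 h.disjoint (h.mem_of_gt_p i (not_le.1 hlt)) hi
      · exact (Finset.mem_filter.1 hi).2.le
    · rintro ⟨h1, h2⟩
      refine ⟨?_, fun h3 => h1.ne' h3.2⟩
      rcases Finset.mem_union.1 (h.mem_of_gt_q i h1) with hi | hi
      · exact Finset.mem_union_right _
          (Finset.mem_filter.2 ⟨hi, le_antisymm h2 (h.ge_p_of_mem i hi)⟩)
      · exact Finset.mem_union_left _ hi
  refine (splitSurplus_le_of_demote h.disjoint hqp h.ge_p_of_mem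
    (fun i hi => h.ge_q_of_mem i (Finset.mem_union_right _ hi))
    (Finset.filter_subset (fun i => v i = p) S) fun i hi => (Finset.mem_filter.1 hi).2).trans ?_
  refine (splitSurplus_le_of_drop hqp hT (Finset.filter_subset (fun i => v i = q) _)
    fun i hi => (Finset.mem_filter.1 hi).2).trans ?_
  rw [hSp, hTq, pqSurplus]

theorem IsSplit.splitSurplus_nonneg {n : ℕ} (k : ℕ) {v : Fin n → ℝ} {p q : ℝ}
    {S T : Finset (Fin n)} (h : IsSplit v p q S T) (hqp : q ≤ p) :
    0 ≤ splitSurplus k S T p q v := by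
  have h1 : 0 ≤ ∑ i ∈ S, (v i - p) :=
    Finset.sum_nonneg fun i hi => sub_nonneg.2 (h.ge_p_of_mem i hi)
  have h2 : 0 ≤ ∑ i ∈ T, (v i - q) :=
    Finset.sum_nonneg fun i hi => sub_nonneg.2 (h.ge_q_of_mem i (Finset.mem_union_right _ hi))
  have h3 : 0 ≤ p - q := sub_nonneg.2 hqp
  have r1 := rate_nonneg k S.card
  have r2 := rate_nonneg (k + 1 - S.card) (T.card + 1)
  have r3 := rate_nonneg (k - S.card) T.card
  unfold splitSurplus
  positivity

end

end MoneyBurning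

namespace MoneyBurning

noncomputable section

open Filter Topology

/-! ### Comparison with single-price lotteries -/

theorem pqSurplus_self {n : ℕ} (k : ℕ) (v : Fin n → ℝ) (p : ℝ) :
    pqSurplus k v p p = rate k (Finset.univ.filter fun i => p < v i).card *
      ∑ i ∈ Finset.univ.filter (fun i => p < v i), (v i - p) := by
  have hT : (Finset.univ.filter fun i => p < v i ∧ v i ≤ p) = ∅ := by
    ext i
    simp
  rw [pqSurplus, splitSurplus, hT]
  simp

/-- Return the other `s - 1` priority agents to the lottery together with their `s - 1` units. -/
theorem rate_add_one_le {k s t : ℕ} (hs : 0 < s) : rate (k + 1 - s) (t + 1) ≤ rate k (s + t) := by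
  rcases Nat.lt_or_ge k s with h | h
  · rw [show k + 1 - s = 0 by omega, rate_zero_left]
    exact rate_nonneg _ _
  · exact rate_le_rate_of_add (s - 1) (by omega) (by omega)

theorem rate_sub_le {k s t : ℕ} : rate (k - s) t ≤ rate k (s + t) := by
  rcases Nat.lt_or_ge k s with h | h
  · rw [show k - s = 0 by omega, rate_zero_left]
    exact rate_nonneg _ _
  · exact rate_le_rate_of_add s (by omega) (by omega)

/-- The first term of `splitSurplus` is the `p`-lottery. The chances in the other two are at most
that of the `q`-lottery, where an agent of `S` gains `(v i - p) + (p - q)`. The unused share of `v i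
- p` is kept on the left, because a strict comparison is needed later. -/
theorem pqSurplus_add_le {n : ℕ} (k : ℕ) (v : Fin n → ℝ) {p q : ℝ} (hqp : q ≤ p) :
    pqSurplus k v p q + rate k (Finset.univ.filter fun i => q < v i).card *
      ∑ i ∈ Finset.univ.filter (fun i => p < v i), (v i - p) ≤
      pqSurplus k v p p + pqSurplus k v q q := by
  rw [pqSurplus_self, pqSurplus_self, pqSurplus, splitSurplus]
  set S := Finset.univ.filter fun i => p < v i with hS
  set T := Finset.univ.filter fun i => q < v i ∧ v i ≤ p with hT
  have hdisj : Disjoint S T := by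
    rw [Finset.disjoint_left]
    intro i h1 h2
    simp only [hS, hT, Finset.mem_filter, Finset.mem_univ, true_and] at h1 h2
    exact absurd h1 h2.2.not_gt
  have hU : (Finset.univ.filter fun i => q < v i) = S ∪ T := by
    ext i
    simp only [hS, hT, Finset.mem_filter, Finset.mem_univ, true_and, Finset.mem_union]
    constructor
    · exact fun h => (lt_or_ge p (v i)).imp_right fun h' => ⟨h, h'⟩
    · exact fun h => h.elim (fun h => hqp.trans_lt h) fun h => h.1
  rw [hU, Finset.card_union_of_disjoint hdisj, Finset.sum_union hdisj]
  have hsum : ∑ i ∈ S, (v i - q) = ∑ i ∈ S, (v i - p) + S.card * (p - q) := by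
    rw [← nsmul_eq_mul, ← Finset.sum_const, ← Finset.sum_add_distrib]
    exact Finset.sum_congr rfl fun i _ => by ring
  rw [hsum]
  have h0T : 0 ≤ ∑ i ∈ T, (v i - q) := Finset.sum_nonneg fun i hi => by
    simp only [hT, Finset.mem_filter, Finset.mem_univ, true_and] at hi
    linarith [hi.1]
  have hpq : 0 ≤ p - q := sub_nonneg.2 hqp
  have h1 : S.card * rate (k + 1 - S.card) (T.card + 1) * (p - q)
      ≤ S.card * rate k (S.card + T.card) * (p - q) := by
    rcases Nat.eq_zero_or_pos S.card with h | h
    · simp [h]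
    · gcongr
      exact rate_add_one_le h
  have h2 : rate (k - S.card) T.card * ∑ i ∈ T, (v i - q)
      ≤ rate k (S.card + T.card) * ∑ i ∈ T, (v i - q) :=
    mul_le_mul_of_nonneg_right rate_sub_le h0T
  nlinarith [h1, h2]

theorem sum_above_nonneg {n : ℕ} (v : Fin n → ℝ) (p : ℝ) :
    0 ≤ ∑ i ∈ Finset.univ.filter (fun i => p < v i), (v i - p) :=
  Finset.sum_nonneg fun _ hi => sub_nonneg.2 (Finset.mem_filter.1 hi).2.le

theorem pqSurplus_le_add {n : ℕ} (k : ℕ) (v : Fin n → ℝ) {p q : ℝ} (hqp : q ≤ p) :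
    pqSurplus k v p q ≤ pqSurplus k v p p + pqSurplus k v q q := by
  have := mul_nonneg (rate_nonneg k (Finset.univ.filter fun i => q < v i).card)
    (sum_above_nonneg v p)
  linarith [pqSurplus_add_le k v hqp]

theorem pLottery_surplus {n : ℕ} (k : ℕ) (v : Fin n → ℝ) (p : ℝ) :
    (pLottery k p v).surplus v = rate k (Finset.univ.filter fun i => p ≤ v i).card *
      ∑ i ∈ Finset.univ.filter (fun i => p ≤ v i), (v i - p) :=
  lotteryOn_surplus _ _ _ _

theorem pLottery_surplus_nonneg {n : ℕ} (k : ℕ) (v : Fin n → ℝ) (p : ℝ) :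
    0 ≤ (pLottery k p v).surplus v := by
  rw [pLottery_surplus]
  exact mul_nonneg (rate_nonneg _ _)
    (Finset.sum_nonneg fun i hi => sub_nonneg.2 (Finset.mem_filter.1 hi).2)

theorem pLottery_surplus_of_ne {n : ℕ} (k : ℕ) {v : Fin n → ℝ} {p : ℝ} (h : ∀ i, v i ≠ p) :
    (pLottery k p v).surplus v = pqSurplus k v p p := by
  have : (Finset.univ.filter fun i => p ≤ v i) = Finset.univ.filter fun i => p < v i := by
    ext i
    simp [lt_iff_le_and_ne, (h i).symm]
  rw [pLottery_surplus, pqSurplus_self, this]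

theorem eventually_nhdsGT_lt_iff {n : ℕ} (v : Fin n → ℝ) (c : ℝ) :
    ∀ᶠ τ in 𝓝[>] c, ∀ i, τ < v i ↔ c < v i := by
  refine eventually_all.2 fun i => ?_
  rcases lt_or_ge c (v i) with h | h
  · filter_upwards [mem_nhdsWithin_of_mem_nhds (Iio_mem_nhds h)] with τ hτ
    exact iff_of_true hτ h
  · filter_upwards [self_mem_nhdsWithin] with τ hτ
    exact iff_of_false (h.trans (le_of_lt hτ)).not_gt h.not_gt

theorem eventually_nhdsLT_lt_iff {n : ℕ} (v : Fin n → ℝ) (c : ℝ) :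
    ∀ᶠ τ in 𝓝[<] c, ∀ i, τ < v i ↔ c ≤ v i := by
  refine eventually_all.2 fun i => ?_
  rcases lt_or_ge (v i) c with h | h
  · filter_upwards [mem_nhdsWithin_of_mem_nhds (Ioi_mem_nhds h)] with τ hτ
    exact iff_of_false (le_of_lt hτ).not_gt h.not_ge
  · filter_upwards [self_mem_nhdsWithin] with τ hτ
    exact iff_of_true (lt_of_lt_of_le hτ h) h

/-- A price slightly above `r` admits exactly the agents strictly above `r` and costs arbitrarily
little; hence the strict bound on `y`. -/
theorem exists_pLottery_gt {n : ℕ} (k : ℕ) (v : Fin n → ℝ) {r y : ℝ} (hr : 0 ≤ r)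
    (hy : y < pqSurplus k v r r) : ∃ p : ℝ, 0 ≤ p ∧ y ≤ (pLottery k p v).surplus v := by
  set S := Finset.univ.filter fun i => r < v i with hS
  have hcont : ContinuousAt (fun τ => rate k S.card * ∑ i ∈ S, (v i - τ)) r := by fun_prop
  have h1 : ∀ᶠ τ in 𝓝[>] r, y < rate k S.card * ∑ i ∈ S, (v i - τ) := by
    refine mem_nhdsWithin_of_mem_nhds (hcont.eventually_const_lt ?_)
    rwa [pqSurplus_self] at hy
  obtain ⟨σ, hσ, hiff, hrσ : r < σ⟩ := (h1.and ((eventually_nhdsGT_lt_iff v r).and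
    self_mem_nhdsWithin)).exists
  refine ⟨σ, hr.trans hrσ.le, hσ.le.trans ?_⟩
  have hset : (Finset.univ.filter fun i => σ ≤ v i) = S := by
    ext i
    simp only [hS, Finset.mem_filter, Finset.mem_univ, true_and]
    constructor
    · exact fun h => hrσ.trans_le h
    · exact fun h => ((hiff i).2 h).le
  rw [pLottery_surplus, hset]

theorem exists_pLottery_ge_half {n : ℕ} (k : ℕ) (v : Fin n → ℝ) {p q : ℝ} (hq : 0 ≤ q)
    (hqp : q ≤ p) : ∃ p' : ℝ, 0 ≤ p' ∧ pqSurplus k v p q / 2 ≤ (pLottery k p' v).surplus v := by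
  rcases le_or_gt (pqSurplus k v p q) 0 with h0 | h0
  · exact ⟨0, le_rfl, by linarith [pLottery_surplus_nonneg k v 0]⟩
  -- If neither exceeded half, the slack in `pqSurplus_add_le` would vanish. Then the `p`-lottery
  -- has surplus `0`, and the `q`-lottery alone dominates the positive total, a contradiction.
  have hmain : pqSurplus k v p q / 2 < pqSurplus k v p p ∨
      pqSurplus k v p q / 2 < pqSurplus k v q q := by
    by_contra! hcon
    have hadd := pqSurplus_add_le k v hqp
    have hnn := mul_nonneg (rate_nonneg k (Finset.univ.filter fun i => q < v i).card)
      (sum_above_nonneg v p)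
    have hz : rate k (Finset.univ.filter fun i => q < v i).card *
        ∑ i ∈ Finset.univ.filter (fun i => p < v i), (v i - p) = 0 :=
      le_antisymm (by linarith [hcon.1, hcon.2]) hnn
    have hpp : pqSurplus k v p p = 0 := by
      rw [pqSurplus_self]
      rcases mul_eq_zero.1 hz with h | h
      · have hk : rate k (Finset.univ.filter fun i => p < v i).card = 0 := by
          rcases Nat.eq_zero_or_pos k with rfl | hk
          · exact rate_zero_left _
          · unfold rate at h
            have : (0 : ℝ) < k := by exact_mod_cast hk
            have h' : (0 : ℝ) < max (k : ℝ)
              (Finset.univ.filter fun i => q < v i).card := lt_max_of_lt_left this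
            exact absurd h (by positivity)
        rw [hk, zero_mul]
      · rw [h, mul_zero]
    linarith [hcon.1, hcon.2, pqSurplus_le_add k v hqp]
  rcases hmain with h | h
  · exact exists_pLottery_gt k v (hq.trans hqp) h
  · exact exists_pLottery_gt k v hq h

/-! ### The range of the residual surplus of `(p,q)`-lotteries -/

/-- With the classes fixed, a higher `p` costs the priority agents at rate `rate k S.card` and
returns at most that rate as rebate. -/
theorem splitSurplus_anti {n k : ℕ} {S T : Finset (Fin n)} {v : Fin n → ℝ} {p q p' q' : ℝ}
    (hp : p' ≤ p) (hq : q' ≤ q) : splitSurplus k S T p q v ≤ splitSurplus k S T p' q' v := by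
  have hy : S.card * rate (k + 1 - S.card) (T.card + 1) ≤ S.card * rate k S.card := by
    rcases Nat.eq_zero_or_pos S.card with h | h
    · simp [h]
    · gcongr
      exact (rate_add_one_le (t := T.card) h).trans (rate_mono le_rfl (by omega))
  have hy0 : 0 ≤ S.card * rate (k + 1 - S.card) (T.card + 1) :=
    mul_nonneg (Nat.cast_nonneg _) (rate_nonneg _ _)
  have hx0 : 0 ≤ rate (k - S.card) T.card * T.card :=
    mul_nonneg (rate_nonneg _ _) (Nat.cast_nonneg _)
  simp only [splitSurplus, Finset.sum_sub_distrib, Finset.sum_const, nsmul_eq_mul]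
  nlinarith [mul_le_mul_of_nonneg_right hy (sub_nonneg.2 hp),
    mul_nonneg hy0 (sub_nonneg.2 hq), mul_nonneg hx0 (sub_nonneg.2 hq)]

/-- Rounding both thresholds down to the finite set `C` leaves the classes unchanged and only lowers
prices, so a maximum over `C` is global. -/
theorem exists_pqSurplus_isMax {n : ℕ} (k : ℕ) {v : Fin n → ℝ} (hv : ∀ i, 0 ≤ v i) :
    ∃ p q : ℝ, 0 ≤ q ∧ q ≤ p ∧
      ∀ p' q' : ℝ, 0 ≤ q' → q' ≤ p' → pqSurplus k v p' q' ≤ pqSurplus k v p q := by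
  set C : Finset ℝ := insert 0 (Finset.univ.image v) with hC
  have hC0 : ∀ c ∈ C, 0 ≤ c := by
    intro c hc
    rcases Finset.mem_insert.1 hc with rfl | hc
    · exact le_rfl
    · obtain ⟨i, -, rfl⟩ := Finset.mem_image.1 hc
      exact hv i
  have hvC : ∀ i, v i ∈ C := fun i =>
    Finset.mem_insert_of_mem (Finset.mem_image_of_mem v (Finset.mem_univ i))
  have h0C : (0 : ℝ) ∈ C := Finset.mem_insert_self _ _
  obtain ⟨⟨p, q⟩, hmem, hmax⟩ := Finset.exists_max_image
    ((C ×ˢ C).filter fun x => x.2 ≤ x.1) (fun x => pqSurplus k v x.1 x.2)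
    ⟨(0, 0), by simp [h0C]⟩
  simp only [Finset.mem_filter, Finset.mem_product] at hmem
  refine ⟨p, q, hC0 q hmem.1.2, hmem.2, fun p' q' hq' hqp' => ?_⟩
  have hfloor : ∀ r : ℝ, 0 ≤ r → ∃ c ∈ C, c ≤ r ∧ ∀ x ∈ C, x ≤ r → x ≤ c := by
    intro r hr
    obtain ⟨c, hc, hcm⟩ := Finset.exists_max_image (C.filter fun x => x ≤ r) id
      ⟨0, by simp [h0C, hr]⟩
    rw [Finset.mem_filter] at hc
    exact ⟨c, hc.1, hc.2, fun x hx hxr => hcm x (Finset.mem_filter.2 ⟨hx, hxr⟩)⟩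
  obtain ⟨a, haC, hap, ha⟩ := hfloor p' (hq'.trans hqp')
  obtain ⟨b, hbC, hbq, hb⟩ := hfloor q' hq'
  have hia : ∀ i, v i ≤ p' ↔ v i ≤ a := fun i => ⟨ha _ (hvC i), fun h => h.trans hap⟩
  have hib : ∀ i, v i ≤ q' ↔ v i ≤ b := fun i => ⟨hb _ (hvC i), fun h => h.trans hbq⟩
  have hba : b ≤ a := ha b hbC (hbq.trans hqp')
  refine le_trans ?_ (hmax (a, b) (by simp [haC, hbC, hba]))
  simp only [pqSurplus, ← not_le, hia, hib]
  exact splitSurplus_anti hap hbq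

/-- A function that is right-continuous and has only upward jumps on the left attains, on an
interval, every value below its initial value, unless it ends above this value. -/
theorem exists_eq_or_lt_of_upward_jumps {f : ℝ → ℝ} {a b x : ℝ} (hab : a ≤ b) (hx : x ≤ f a)
    (hright : ∀ c, a ≤ c → c < b → ∃ g : ℝ → ℝ, ContinuousAt g c ∧ g c = f c ∧ f =ᶠ[𝓝[>] c] g)
    (hleft : ∀ c, a < c → c ≤ b → ∃ g : ℝ → ℝ, ContinuousAt g c ∧ g c ≤ f c ∧ f =ᶠ[𝓝[<] c] g) :
    (∃ c, a ≤ c ∧ c ≤ b ∧ f c = x) ∨ x < f b := by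
  -- At the supremum `c` of `A`, having only upward jumps on the left forces `x ≤ f c`, and right
  -- continuity excludes `x < f c` unless `c = b`.
  set A : Set ℝ := {τ | (a ≤ τ ∧ τ ≤ b) ∧ x ≤ f τ} with hA
  have haA : a ∈ A := ⟨⟨le_rfl, hab⟩, hx⟩
  have hbdd : BddAbove A := ⟨b, fun τ hτ => hτ.1.2⟩
  have hlub : IsLUB A (sSup A) := isLUB_csSup ⟨a, haA⟩ hbdd
  set c := sSup A
  have hac : a ≤ c := hlub.1 haA
  have hcb : c ≤ b := hlub.2 fun τ hτ => hτ.1.2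
  have hxc : x ≤ f c := by
    rcases hac.eq_or_lt with h | h
    · rwa [← h]
    obtain ⟨g, hg, hgc, hfg⟩ := hleft c h hcb
    by_contra! hlt
    have h1 : ∀ᶠ τ in 𝓝[<] c, f τ < x := by
      filter_upwards [hfg, mem_nhdsWithin_of_mem_nhds
        (hg.eventually_lt_const (hgc.trans_lt hlt))] with τ h1 h2
      rwa [h1]
    have h2 : ∀ᶠ τ in 𝓝[≤] c, f τ < x := by
      rw [← Set.Iio_insert, nhdsWithin_insert, eventually_sup]
      exact ⟨by simpa using hlt, h1⟩
    obtain ⟨τ, hτ, hτ'⟩ := ((hlub.frequently_mem ⟨a, haA⟩).and_eventually h2).exists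
    exact absurd hτ.2 hτ'.not_ge
  rcases hxc.eq_or_lt with h | h
  · exact Or.inl ⟨c, hac, hcb, h.symm⟩
  rcases hcb.eq_or_lt with h' | h'
  · exact Or.inr (by rwa [h'] at h)
  exfalso
  obtain ⟨g, hg, hgc, hfg⟩ := hright c hac h'
  have hev : ∀ᶠ τ in 𝓝[>] c, x < g τ :=
    mem_nhdsWithin_of_mem_nhds (hg.eventually_const_lt (hgc.symm ▸ h))
  obtain ⟨τ, h1, h2, h3⟩ := (hfg.and (hev.and (Ioo_mem_nhdsGT h'))).exists
  exact absurd (hlub.1 (show τ ∈ A from ⟨⟨hac.trans h3.1.le, h3.2.le⟩, by rw [h1]; exact h2.le⟩))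
    h3.1.not_ge

theorem exists_pqSurplus_eq_or_lt_of_raise_left {n : ℕ} (k : ℕ) (v : Fin n → ℝ) {p q x B : ℝ}
    (hqp : q ≤ p) (hpB : p ≤ B) (hx : x ≤ pqSurplus k v p q) :
    (∃ c, p ≤ c ∧ c ≤ B ∧ pqSurplus k v c q = x) ∨ x < pqSurplus k v B q := by
  refine exists_eq_or_lt_of_upward_jumps (f := fun τ => pqSurplus k v τ q) hpB hx ?_ ?_
  · intro c _ _
    refine ⟨fun τ => splitSurplus k (Finset.univ.filter fun i => c < v i)
      (Finset.univ.filter fun i => q < v i ∧ v i ≤ c) τ q v, ?_, rfl, ?_⟩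
    · unfold splitSurplus
      fun_prop
    · filter_upwards [eventually_nhdsGT_lt_iff v c] with τ hτ
      have hτ' : ∀ i, v i ≤ τ ↔ v i ≤ c := fun i => by rw [← not_lt, hτ i, not_lt]
      simp only [pqSurplus, hτ, hτ']
  -- Just below `c`, agents with value `c` are still in `S`. This limiting split is admissible at
  -- the threshold `c`, so `IsSplit.splitSurplus_le` makes the jump upward.
  · intro c hpc _
    refine ⟨fun τ => splitSurplus k (Finset.univ.filter fun i => c ≤ v i)
      (Finset.univ.filter fun i => q < v i ∧ v i < c) τ q v, ?_, ?_, ?_⟩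
    · unfold splitSurplus
      fun_prop
    · have hqc : q ≤ c := hqp.trans hpc.le
      refine IsSplit.splitSurplus_le k ⟨?_, ?_, ?_, ?_, ?_, ?_⟩ hqc
      · rw [Finset.disjoint_left]
        intro i h1 h2
        exact absurd (Finset.mem_filter.1 h1).2 (Finset.mem_filter.1 h2).2.2.not_ge
      · simpa using fun i hi => le_of_lt hi
      · simp
      · simpa using fun i hi => (le_or_gt c (v i)).imp_right fun h => ⟨hi, h⟩
      · simpa using fun i hi => hi.elim (fun h => hqc.trans h) fun h => h.1.le
      · intro i j hij
        simp [hij]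
    · filter_upwards [eventually_nhdsLT_lt_iff v c] with τ hτ
      have hτ' : ∀ i, v i ≤ τ ↔ v i < c := fun i => by rw [← not_lt, hτ i, not_le]
      simp only [pqSurplus, hτ, hτ']

theorem exists_pqSurplus_eq_or_lt_of_raise_right {n : ℕ} (k : ℕ) {v : Fin n → ℝ} {q x B : ℝ}
    (hvB : ∀ i, v i ≤ B) (hqB : q ≤ B) (hx : x ≤ pqSurplus k v B q) :
    (∃ c, q ≤ c ∧ c ≤ B ∧ pqSurplus k v B c = x) ∨ x < pqSurplus k v B B := by
  refine exists_eq_or_lt_of_upward_jumps (f := fun τ => pqSurplus k v B τ) hqB hx ?_ ?_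
  · intro c _ _
    refine ⟨fun τ => splitSurplus k (Finset.univ.filter fun i => B < v i)
      (Finset.univ.filter fun i => c < v i ∧ v i ≤ B) B τ v, ?_, rfl, ?_⟩
    · unfold splitSurplus
      fun_prop
    · filter_upwards [eventually_nhdsGT_lt_iff v c] with τ hτ
      simp only [pqSurplus, hτ]
  · intro c _ hcB
    refine ⟨fun τ => splitSurplus k (Finset.univ.filter fun i => B < v i)
      (Finset.univ.filter fun i => c ≤ v i ∧ v i ≤ B) B τ v, ?_, ?_, ?_⟩
    · unfold splitSurplus
      fun_prop
    · refine IsSplit.splitSurplus_le k ⟨?_, ?_, ?_, ?_, ?_, ?_⟩ hcB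
      · rw [Finset.disjoint_left]
        intro i h1 h2
        exact absurd (Finset.mem_filter.1 h1).2 (Finset.mem_filter.1 h2).2.2.not_gt
      · simp
      · simpa using fun i hi => le_of_lt hi
      · simpa using fun i hi => Or.inr ⟨le_of_lt hi, hvB i⟩
      · simpa using fun i hi => hi.elim (fun h => hcB.trans h.le) fun h => h.1
      · intro i j hij
        simp [hij]
    · filter_upwards [eventually_nhdsLT_lt_iff v c] with τ hτ
      simp only [pqSurplus, hτ]

/-- Raise `p` beyond all values, then `q` as well; the surplus ends at `0`, so the level `x` is met
on the way. -/
theorem exists_pqSurplus_eq {n : ℕ} (k : ℕ) (v : Fin n → ℝ) {p q x : ℝ} (hq : 0 ≤ q)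
    (hqp : q ≤ p) (hx0 : 0 ≤ x) (hx : x ≤ pqSurplus k v p q) :
    ∃ p' q' : ℝ, 0 ≤ q' ∧ q' ≤ p' ∧ pqSurplus k v p' q' = x := by
  obtain ⟨B, hpB, hvB⟩ : ∃ B, p ≤ B ∧ ∀ i, v i ≤ B := by
    obtain ⟨B, hB⟩ := (Set.finite_range v).bddAbove
    exact ⟨max p B, le_max_left _ _, fun i => (hB ⟨i, rfl⟩).trans (le_max_right _ _)⟩
  rcases exists_pqSurplus_eq_or_lt_of_raise_left k v hqp hpB hx with ⟨c, hc1, -, hc⟩ | hlt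
  · exact ⟨c, q, hq, hqp.trans hc1, hc⟩
  rcases exists_pqSurplus_eq_or_lt_of_raise_right k hvB (hqp.trans hpB) hlt.le with
    ⟨c, hc1, hc2, hc⟩ | hlt'
  · exact ⟨B, c, hq.trans hc1, hc2, hc⟩
  · have hemp : (Finset.univ.filter fun i => B < v i) = ∅ :=
      Finset.filter_false_of_mem fun i _ => (hvB i).not_gt
    rw [pqSurplus_self, hemp, Finset.sum_empty, mul_zero] at hlt'
    exact absurd hx0 hlt'.not_ge

end

end MoneyBurning

namespace MoneyBurning

noncomputable section

open Filter Topology MeasureTheory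

/-! ### One-sided derivatives of convex functions on the unit interval -/

/-- Monotonicity bounds the slopes below by `0`, which rules out the right derivative `-∞` at `0`.
-/
theorem convexOn_hasDerivWithinAt_right {φ : ℝ → ℝ} (hφ : ConvexOn ℝ (Set.Icc 0 1) φ)
    (hmono : MonotoneOn φ (Set.Icc 0 1)) {a : ℝ} (ha : 0 ≤ a) (ha1 : a < 1) :
    HasDerivWithinAt φ (derivWithin φ (Set.Icc a 1) a) (Set.Icc a 1) a := by
  have hsub : Set.Ioo a 1 ⊆ {y | y ∈ Set.Icc (0 : ℝ) 1 ∧ a < y} := fun y hy =>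
    ⟨⟨ha.trans hy.1.le, hy.2.le⟩, hy.1⟩
  have haI : a ∈ Set.Icc (0 : ℝ) 1 := ⟨ha, ha1.le⟩
  have ht : Tendsto (slope φ a) (𝓝[>] a) (𝓝 (sInf (slope φ a '' Set.Ioo a 1))) := by
    refine ((hφ.monotoneOn_slope_gt haI).mono hsub).tendsto_nhdsWithin_Ioo_right
      (by simpa using ha1) ⟨0, ?_⟩
    rintro _ ⟨y, hy, rfl⟩
    rw [slope_def_field]
    exact div_nonneg (sub_nonneg.2 (hmono haI (hsub hy).1 hy.1.le)) (sub_nonneg.2 hy.1.le)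
  have hd : HasDerivWithinAt φ (sInf (slope φ a '' Set.Ioo a 1)) (Set.Ioi a) a := by
    rw [hasDerivWithinAt_iff_tendsto_slope]
    simpa using ht
  exact ((hasDerivWithinAt_Ioi_iff_Ici.1 hd).mono
    Set.Icc_subset_Ici_self).differentiableWithinAt.hasDerivWithinAt

/-- A convex function may have left derivative `+∞` at `1`, where `derivWithin` would take the
default value `0` and spoil monotonicity. The chord bound `C` excludes this. -/
theorem convexOn_hasDerivWithinAt_one {φ : ℝ → ℝ} (hφ : ConvexOn ℝ (Set.Icc 0 1) φ) {C : ℝ}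
    (hC : ∀ r ∈ Set.Icc (0 : ℝ) 1, φ 1 - φ r ≤ C * (1 - r)) :
    HasDerivWithinAt φ (derivWithin φ (Set.Icc 0 1) 1) (Set.Icc 0 1) 1 := by
  have hsub : Set.Ioo (0 : ℝ) 1 ⊆ {y | y ∈ Set.Icc (0 : ℝ) 1 ∧ y < 1} := fun y hy =>
    ⟨⟨hy.1.le, hy.2.le⟩, hy.2⟩
  have ht : Tendsto (slope φ 1) (𝓝[<] 1) (𝓝 (sSup (slope φ 1 '' Set.Ioo 0 1))) := by
    refine ((hφ.monotoneOn_slope_lt (by simp)).mono hsub).tendsto_nhdsWithin_Ioo_left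
      (by simp) ⟨C, ?_⟩
    rintro _ ⟨y, hy, rfl⟩
    rw [slope_comm, slope_def_field, div_le_iff₀ (sub_pos.2 hy.2)]
    exact hC y (hsub hy).1
  have hd : HasDerivWithinAt φ (sSup (slope φ 1 '' Set.Ioo 0 1)) (Set.Iio 1) 1 := by
    rw [hasDerivWithinAt_iff_tendsto_slope]
    simpa using ht
  exact ((hasDerivWithinAt_Iio_iff_Iic.1 hd).mono
    Set.Icc_subset_Iic_self).differentiableWithinAt.hasDerivWithinAt

theorem convexOn_derivWithin_right_le_slope {φ : ℝ → ℝ} (hφ : ConvexOn ℝ (Set.Icc 0 1) φ)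
    (hmono : MonotoneOn φ (Set.Icc 0 1)) {a b : ℝ} (ha : 0 ≤ a) (hab : a < b) (hb : b ≤ 1) :
    derivWithin φ (Set.Icc a 1) a ≤ slope φ a b := by
  have ha1 := hab.trans_le hb
  exact (hφ.subset (Set.Icc_subset_Icc_left ha) (convex_Icc a 1)).derivWithin_le_slope
    ⟨le_rfl, ha1.le⟩ ⟨hab.le, hb⟩ hab
    (convexOn_hasDerivWithinAt_right hφ hmono ha ha1).differentiableWithinAt

theorem convexOn_slope_le_derivWithin_right {φ : ℝ → ℝ} (hφ : ConvexOn ℝ (Set.Icc 0 1) φ)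
    (hmono : MonotoneOn φ (Set.Icc 0 1)) {a b : ℝ} (ha : 0 ≤ a) (hab : a < b) (hb : b < 1) :
    slope φ a b ≤ derivWithin φ (Set.Icc b 1) b := by
  have hd := convexOn_hasDerivWithinAt_right hφ hmono (ha.trans hab.le) hb
  rw [hasDerivWithinAt_iff_tendsto_slope, Set.Icc_sdiff_left] at hd
  have : (𝓝[Set.Ioc b 1] b).NeBot := by
    rw [nhdsWithin_Ioc_eq_nhdsGT hb]
    infer_instance
  refine ge_of_tendsto hd ?_
  filter_upwards [self_mem_nhdsWithin] with y hy
  rw [slope_def_field, slope_def_field]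
  exact hφ.slope_mono_adjacent ⟨ha, (hab.trans hb).le⟩ ⟨ha.trans (hab.trans hy.1).le, hy.2⟩
    hab hy.1

/-! ### The ironed virtual valuation is nonnegative and monotone -/

namespace Prior

variable (D : Prior)

/-! ### Distribution function, quantile and probability integral transform. -/

theorem density_nonneg (z : ℝ) : 0 ≤ D.density z := by
  by_cases h : z ∈ D.support
  · exact (D.density_pos z h).le
  · exact (D.density_eq_zero z h).ge

theorem cdf_mono : Monotone D.cdf := fun _ _ h =>
  setIntegral_mono_set D.integrable_density.integrableOn
    (Eventually.of_forall D.density_nonneg) (Set.Iic_subset_Iic.2 h).eventuallyLE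

theorem cdf_nonneg (z : ℝ) : 0 ≤ D.cdf z := integral_nonneg D.density_nonneg

theorem cdf_le_one (z : ℝ) : D.cdf z ≤ 1 := by
  rw [← D.integral_density]
  exact setIntegral_le_integral D.integrable_density (Eventually.of_forall D.density_nonneg)

theorem cdf_sub_cdf {a b : ℝ} (hab : a ≤ b) :
    D.cdf b - D.cdf a = ∫ t in Set.Ioc a b, D.density t := by
  rw [← intervalIntegral.integral_of_le hab, cdf, cdf,
    intervalIntegral.integral_Iic_sub_Iic D.integrable_density.integrableOn
      D.integrable_density.integrableOn]

theorem continuous_cdf : Continuous D.cdf := by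
  have h : D.cdf = fun z => D.cdf 0 + ∫ t in (0 : ℝ)..z, D.density t := by
    funext z
    rw [cdf, cdf, ← intervalIntegral.integral_Iic_sub_Iic D.integrable_density.integrableOn
      D.integrable_density.integrableOn]
    ring
  rw [h]
  exact continuous_const.add
    (intervalIntegral.continuous_primitive (fun _ _ => D.integrable_density.intervalIntegrable) 0)

theorem cdf_lt_cdf {a b : ℝ} (hab : a < b) (h : Set.Ioo a b ⊆ D.support) :
    D.cdf a < D.cdf b := by
  rw [← sub_pos, D.cdf_sub_cdf hab.le, integral_Ioc_eq_integral_Ioo,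
    setIntegral_pos_iff_support_of_nonneg_ae (Eventually.of_forall D.density_nonneg)
      D.integrable_density.integrableOn]
  have hsub : Set.Ioo a b ⊆ Function.support D.density ∩ Set.Ioo a b := fun z hz =>
    ⟨(D.density_pos z (h hz)).ne', hz⟩
  exact lt_of_lt_of_le (by simpa using hab) (measure_mono hsub)

theorem cdf_of_neg {z : ℝ} (hz : z < 0) : D.cdf z = 0 := by
  refine setIntegral_eq_zero_of_forall_eq_zero fun t ht => D.density_eq_zero t fun hs => ?_
  exact absurd (D.support_nonneg t hs) (lt_of_le_of_lt ht hz).not_ge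

theorem tendsto_cdf_atTop : Tendsto D.cdf atTop (𝓝 1) := by
  have h := (aecover_Iic (μ := volume) tendsto_id).integral_tendsto_of_countably_generated
    D.integrable_density
  rwa [D.integral_density] at h

theorem le_of_cdf_eq_one {z w : ℝ} (hz : D.cdf z = 1) (hw : w ∈ D.support) : w ≤ z := by
  by_contra! hlt
  obtain ⟨u, huz, hu⟩ : ∃ u ≤ z, u ∈ D.support := by
    by_contra! hcon
    have : D.cdf z = 0 :=
      setIntegral_eq_zero_of_forall_eq_zero fun t ht => D.density_eq_zero t (hcon t ht)
    linarith
  have := D.cdf_lt_cdf hlt fun t ht =>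
    D.ordConnected_support.out hu hw ⟨huz.trans ht.1.le, ht.2.le⟩
  linarith [D.cdf_le_one w]

theorem quantile_cdf {z : ℝ} (hz : z ∈ D.support) : D.quantile (D.cdf z) = z := by
  refine IsLeast.csInf_eq ⟨⟨hz, le_rfl⟩, fun w hw => ?_⟩
  by_contra! hlt
  exact absurd hw.2 (D.cdf_lt_cdf hlt fun t ht =>
    D.ordConnected_support.out hw.1 hz ⟨ht.1.le, ht.2.le⟩).not_ge

/-- The distribution with the given density. -/
def law : Measure ℝ := volume.withDensity fun z => ENNReal.ofReal (D.density z)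

theorem law_Iic (z : ℝ) : D.law (Set.Iic z) = ENNReal.ofReal (D.cdf z) := by
  rw [law, withDensity_apply _ measurableSet_Iic, cdf,
    ofReal_integral_eq_lintegral_ofReal D.integrable_density.integrableOn
      (Eventually.of_forall D.density_nonneg)]

theorem law_univ : D.law Set.univ = 1 := by
  rw [law, withDensity_apply _ MeasurableSet.univ, Measure.restrict_univ,
    ← ofReal_integral_eq_lintegral_ofReal D.integrable_density
      (Eventually.of_forall D.density_nonneg), D.integral_density, ENNReal.ofReal_one]

/-- The probability integral transform. -/
theorem map_cdf_law : D.law.map D.cdf = volume.restrict (Set.Ioc 0 1) := by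
  have : IsFiniteMeasure D.law := ⟨by rw [law_univ]; exact ENNReal.one_lt_top⟩
  refine Measure.ext_of_Iic _ _ fun r => ?_
  rw [Measure.map_apply D.continuous_cdf.measurable measurableSet_Iic,
    Measure.restrict_apply measurableSet_Iic]
  rcases lt_or_ge r 0 with hr | hr
  · have h1 : D.cdf ⁻¹' Set.Iic r = ∅ := by
      ext z
      simpa using hr.trans_le (D.cdf_nonneg z)
    have h2 : Set.Iic r ∩ Set.Ioc 0 1 = ∅ := by
      ext z
      simp only [Set.mem_inter_iff, Set.mem_Iic, Set.mem_Ioc, Set.mem_empty_iff_false, iff_false]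
      intro h
      linarith [h.1, h.2.1]
    rw [h1, h2, measure_empty, measure_empty]
  rcases le_or_gt 1 r with hr1 | hr1
  · have h1 : D.cdf ⁻¹' Set.Iic r = Set.univ := by
      ext z
      simpa using (D.cdf_le_one z).trans hr1
    have h2 : Set.Iic r ∩ Set.Ioc 0 1 = Set.Ioc 0 1 :=
      Set.inter_eq_right.2 fun z hz => hz.2.trans hr1
    rw [h1, h2, law_univ, Real.volume_Ioc]
    simp
  · have h2 : Set.Iic r ∩ Set.Ioc 0 1 = Set.Ioc 0 r := by
      ext z
      simp only [Set.mem_inter_iff, Set.mem_Iic, Set.mem_Ioc]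
      constructor
      · exact fun h => ⟨h.2.1, h.1⟩
      · exact fun h => ⟨h.2, h.1, h.2.trans hr1.le⟩
    have hne : (D.cdf ⁻¹' Set.Iic r).Nonempty := ⟨-1, by
      simpa [D.cdf_of_neg (show (-1 : ℝ) < 0 by norm_num)] using hr⟩
    obtain ⟨b, hb⟩ := (D.tendsto_cdf_atTop.eventually_const_lt hr1).exists
    have hbdd : BddAbove (D.cdf ⁻¹' Set.Iic r) := ⟨b, fun z hz => by
      by_contra! hlt
      exact absurd (D.cdf_mono hlt.le) (not_le.2 (lt_of_le_of_lt hz hb))⟩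
    -- The sublevel set is the half-line up to its supremum `m`, and continuity gives `F(m) = r`.
    have hmem : sSup (D.cdf ⁻¹' Set.Iic r) ∈ D.cdf ⁻¹' Set.Iic r :=
      (isClosed_Iic.preimage D.continuous_cdf).csSup_mem hne hbdd
    set m := sSup (D.cdf ⁻¹' Set.Iic r) with hm
    have h1 : D.cdf ⁻¹' Set.Iic r = Set.Iic m := by
      ext z
      exact ⟨fun hz => le_csSup hbdd hz, fun hz => (D.cdf_mono hz).trans hmem⟩
    have hcm : D.cdf m = r := by
      refine le_antisymm hmem ?_
      refine ge_of_tendsto (D.continuous_cdf.continuousAt.mono_left nhdsWithin_le_nhds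
        : Tendsto D.cdf (𝓝[>] m) (𝓝 (D.cdf m))) ?_
      filter_upwards [self_mem_nhdsWithin] with z hz
      by_contra! hlt
      exact absurd (le_csSup hbdd (show z ∈ D.cdf ⁻¹' Set.Iic r from hlt.le)) (not_le.2 hz)
    rw [h1, h2, law_Iic, hcm, Real.volume_Ioc, sub_zero]

/-! ### Growth of `H` near `1` for bounded support. -/

theorem virtualValue_nonneg (z : ℝ) : 0 ≤ D.virtualValue z :=
  div_nonneg (sub_nonneg.2 (D.cdf_le_one z)) (D.density_nonneg z)

theorem cumulative_nonneg {r : ℝ} (hr : 0 ≤ r) : 0 ≤ D.cumulative r :=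
  intervalIntegral.integral_nonneg hr fun _ _ => D.virtualValue_nonneg _

/-- Substituting `x = F(z)` cancels the density and leaves `1 - F(z)`, which is at most `1 - r`
where `F(z) > r`; the support lies in `[0, C]`. -/
theorem lintegral_virtualValue_le {C : ℝ} (hC : D.cdf C = 1) {r : ℝ} (hr : 0 ≤ r) :
    ∫⁻ x in Set.Ioc r 1, ENNReal.ofReal (D.virtualValue (D.quantile x))
      ≤ ENNReal.ofReal (C * (1 - r)) := by
  have hC0 : 0 ≤ C := by
    by_contra! h
    linarith [D.cdf_of_neg h]
  set G : ℝ → ENNReal := (Set.Ioc r 1).indicator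
    fun x => ENNReal.ofReal (D.virtualValue (D.quantile x)) with hG
  calc ∫⁻ x in Set.Ioc r 1, ENNReal.ofReal (D.virtualValue (D.quantile x))
      = ∫⁻ x in Set.Ioc 0 1, G x := by
        rw [hG, lintegral_indicator measurableSet_Ioc, Measure.restrict_restrict measurableSet_Ioc,
          Set.inter_eq_left.2 (Set.Ioc_subset_Ioc_left hr)]
    _ = ∫⁻ x, G x ∂(D.law.map D.cdf) := by rw [map_cdf_law]
    -- Here and in the next step the inequality holds without measurability of `G`.
    _ ≤ ∫⁻ z, G (D.cdf z) ∂D.law := lintegral_map_le _ _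
    _ ≤ ∫⁻ z, ENNReal.ofReal (D.density z) * G (D.cdf z) :=
        lintegral_withDensity_le_lintegral_mul _ D.measurable_density.ennreal_ofReal _
    _ ≤ ∫⁻ z, (Set.Icc 0 C).indicator (fun _ => ENNReal.ofReal (1 - r)) z := by
        refine lintegral_mono fun z => ?_
        by_cases hz : z ∈ D.support
        · rw [Set.indicator_of_mem (show z ∈ Set.Icc 0 C from
            ⟨D.support_nonneg z hz, D.le_of_cdf_eq_one hC hz⟩)]
          by_cases hm : D.cdf z ∈ Set.Ioc r 1
          · rw [hG, Set.indicator_of_mem hm, D.quantile_cdf hz,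
              ← ENNReal.ofReal_mul (D.density_nonneg z), virtualValue,
              mul_div_cancel₀ _ (D.density_pos z hz).ne']
            exact ENNReal.ofReal_le_ofReal (by linarith [hm.1])
          · rw [hG, Set.indicator_of_notMem hm, mul_zero]
            exact zero_le
        · rw [D.density_eq_zero z hz, ENNReal.ofReal_zero, zero_mul]
          exact zero_le
    _ = ENNReal.ofReal (C * (1 - r)) := by
        rw [lintegral_indicator measurableSet_Icc, setLIntegral_const, Real.volume_Icc, sub_zero,
          mul_comm, ENNReal.ofReal_mul hC0]

theorem cumulative_one_sub_le {C : ℝ} (hC : D.cdf C = 1) {r : ℝ} (hr : r ∈ Set.Icc (0 : ℝ) 1) :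
    D.cumulative 1 - D.cumulative r ≤ C * (1 - r) := by
  have hC0 : 0 ≤ C := by
    by_contra! h
    linarith [D.cdf_of_neg h]
  have hC1 : 0 ≤ C * (1 - r) := mul_nonneg hC0 (sub_nonneg.2 hr.2)
  by_cases hint : IntervalIntegrable (fun x => D.virtualValue (D.quantile x)) volume 0 1
  · have hr1 : Set.uIcc (0 : ℝ) r ⊆ Set.uIcc 0 1 := by
      rw [Set.uIcc_of_le hr.1, Set.uIcc_of_le zero_le_one]
      exact Set.Icc_subset_Icc_right hr.2
    rw [cumulative, cumulative, intervalIntegral.integral_interval_sub_left hint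
      (hint.mono_set hr1), intervalIntegral.integral_of_le hr.2,
      integral_eq_lintegral_of_nonneg_ae (Eventually.of_forall fun _ => D.virtualValue_nonneg _)]
    · exact ENNReal.toReal_le_of_le_ofReal hC1 (D.lintegral_virtualValue_le hC hr.1)
    · exact (hint.1.mono_set (Set.Ioc_subset_Ioc_left hr.1)).aestronglyMeasurable
  -- A divergent integral has the default value `0`, so the bound is trivial.
  · have h1 : D.cumulative 1 = 0 := intervalIntegral.integral_undef hint
    linarith [D.cumulative_nonneg hr.1]

/-! ### The convex hull of `H` and its slopes. -/

theorem hull_bddAbove {r : ℝ} (hr : r ∈ Set.Icc (0 : ℝ) 1) :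
    BddAbove {y | ∃ φ : ℝ → ℝ, ConvexOn ℝ (Set.Icc 0 1) φ ∧
      (∀ r ∈ Set.Icc (0 : ℝ) 1, φ r ≤ D.cumulative r) ∧ y = φ r} :=
  ⟨D.cumulative r, by rintro _ ⟨φ, -, h, rfl⟩; exact h r hr⟩

theorem le_hull {φ : ℝ → ℝ} (hφ : ConvexOn ℝ (Set.Icc 0 1) φ)
    (h : ∀ r ∈ Set.Icc (0 : ℝ) 1, φ r ≤ D.cumulative r) {r : ℝ} (hr : r ∈ Set.Icc (0 : ℝ) 1) :
    φ r ≤ D.hull r :=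
  le_csSup (D.hull_bddAbove hr) ⟨φ, hφ, h, rfl⟩

theorem hull_le {r y : ℝ} (h : ∀ φ : ℝ → ℝ, ConvexOn ℝ (Set.Icc 0 1) φ →
    (∀ r ∈ Set.Icc (0 : ℝ) 1, φ r ≤ D.cumulative r) → φ r ≤ y) : D.hull r ≤ y := by
  refine csSup_le ⟨0, fun _ => 0, convexOn_const _ (convex_Icc _ _),
    fun r hr => D.cumulative_nonneg hr.1, rfl⟩ ?_
  rintro _ ⟨φ, h1, h2, rfl⟩
  exact h φ h1 h2

theorem hull_nonneg {r : ℝ} (hr : r ∈ Set.Icc (0 : ℝ) 1) : 0 ≤ D.hull r :=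
  D.le_hull (φ := fun _ => 0) (convexOn_const _ (convex_Icc _ _))
    (fun _ hr => D.cumulative_nonneg hr.1) hr

theorem hull_zero : D.hull 0 = 0 := by
  refine le_antisymm (D.hull_le fun φ _ h => ?_) (D.hull_nonneg (by simp))
  simpa [cumulative] using h 0 (by simp)

theorem convexOn_hull : ConvexOn ℝ (Set.Icc 0 1) D.hull := by
  refine ⟨convex_Icc _ _, fun x hx y hy a b ha hb hab => D.hull_le fun φ h1 h2 => ?_⟩
  refine (h1.2 hx hy ha hb hab).trans ?_
  simp only [smul_eq_mul]
  gcongr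
  · exact D.le_hull h1 h2 hx
  · exact D.le_hull h1 h2 hy

/-- A nonnegative convex function that starts at `0` has a nonnegative first chord, hence
nonnegative later ones. -/
theorem monotoneOn_hull : MonotoneOn D.hull (Set.Icc 0 1) := by
  intro x hx y hy hxy
  rcases hxy.eq_or_lt with rfl | hlt
  · exact le_rfl
  rcases hx.1.eq_or_lt with rfl | hx0
  · rw [hull_zero]
    exact D.hull_nonneg hy
  have h := D.convexOn_hull.slope_mono_adjacent (by simp) hy hx0 hlt
  rw [hull_zero, sub_zero, sub_zero] at h
  have h0 : 0 ≤ D.hull x / x := div_nonneg (D.hull_nonneg hx) hx0.le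
  have h1 := h0.trans h
  rw [le_div_iff₀ (sub_pos.2 hlt), zero_mul] at h1
  linarith

/-- The line of slope `C` through `(1, H(1))` is a convex minorant of `H`, hence lies below the
hull. -/
theorem hull_one_sub_le {C : ℝ} (hC : D.cdf C = 1) {r : ℝ} (hr : r ∈ Set.Icc (0 : ℝ) 1) :
    D.hull 1 - D.hull r ≤ C * (1 - r) := by
  have h1 : D.hull 1 ≤ D.cumulative 1 := D.hull_le fun φ _ h => h 1 (by simp)
  have hconv : ConvexOn ℝ (Set.Icc 0 1) fun x : ℝ => D.cumulative 1 - C * (1 - x) := by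
    refine ⟨convex_Icc _ _, fun x _ y _ a b _ _ hab => le_of_eq ?_⟩
    simp only [smul_eq_mul]
    obtain rfl : b = 1 - a := by linarith
    ring
  have h2 := D.le_hull hconv (fun x hx => by linarith [D.cumulative_one_sub_le hC hx]) hr
  linarith

theorem hullSlope_nonneg (r : ℝ) (hr : 0 ≤ r) : 0 ≤ D.hullSlope r := by
  rw [hullSlope]
  split_ifs with h
  · exact (D.monotoneOn_hull.mono (Set.Icc_subset_Icc_left hr)).derivWithin_nonneg
  · exact D.monotoneOn_hull.derivWithin_nonneg

theorem ironedValue_nonneg (z : ℝ) : 0 ≤ D.ironedValue z :=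
  D.hullSlope_nonneg _ (D.cdf_nonneg z)

theorem ironedValue_mono : Monotone D.ironedValue := by
  intro z w hzw
  rw [ironedValue, ironedValue]
  rcases (D.cdf_mono hzw).eq_or_lt with heq | hlt
  · rw [heq]
  have hz0 := D.cdf_nonneg z
  have hz1 : D.cdf z < 1 := hlt.trans_le (D.cdf_le_one w)
  rcases (D.cdf_le_one w).lt_or_eq with hw | hw
  · rw [hullSlope, hullSlope, if_pos hz1, if_pos hw]
    exact (convexOn_derivWithin_right_le_slope D.convexOn_hull D.monotoneOn_hull hz0 hlt
      hw.le).trans (convexOn_slope_le_derivWithin_right D.convexOn_hull D.monotoneOn_hull hz0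
        hlt hw)
  -- The slope at `1` enters only if `F(w) = 1`; then `w` bounds the support and serves as the chord
  -- bound.
  · have hd := convexOn_hasDerivWithinAt_one D.convexOn_hull
      fun r hr => D.hull_one_sub_le hw hr
    rw [hw, hullSlope, hullSlope, if_pos hz1, if_neg (lt_irrefl _)]
    exact (convexOn_derivWithin_right_le_slope D.convexOn_hull D.monotoneOn_hull hz0 hz1
      le_rfl).trans (D.convexOn_hull.slope_le_derivWithin ⟨hz0, hz1.le⟩ (by simp) hz1
        hd.differentiableWithinAt)

end Prior

/-- The uniform prior on `[0, 1]`; without any prior the benchmark would be a default value rather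
than a least upper bound. -/
instance : Nonempty Prior :=
  ⟨{ density := (Set.Icc 0 1).indicator 1
     support := Set.Icc 0 1
     isClosed_support := isClosed_Icc
     ordConnected_support := Set.ordConnected_Icc
     support_nonneg := fun _ hz => hz.1
     measurable_density := measurable_one.indicator measurableSet_Icc
     density_pos := fun z hz => by simp [Set.indicator_of_mem hz]
     density_eq_zero := fun z hz => Set.indicator_of_notMem hz _
     integrable_density := (integrable_indicator_iff measurableSet_Icc).2
      (continuous_one.integrableOn_Icc)
     integral_density := by
      rw [integral_indicator measurableSet_Icc]
      simp
     integrable_mean := by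
      have h : (fun z : ℝ => z * (Set.Icc (0 : ℝ) 1).indicator (1 : ℝ → ℝ) z)
          = (Set.Icc (0 : ℝ) 1).indicator fun z => z := by
        funext z
        by_cases hz : z ∈ Set.Icc (0 : ℝ) 1 <;> simp [Set.indicator, hz]
      rw [h, integrable_indicator_iff measurableSet_Icc]
      exact continuous_id.integrableOn_Icc }⟩

end

end MoneyBurning

namespace MoneyBurning

noncomputable section

open MeasureTheory

/-! ### The winners of the optimal mechanism -/

theorem mem_myeWinners {n : ℕ} {D : Prior} {k : ℕ} {v : Fin n → ℝ} {W : Finset (Fin n)} :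
    W ∈ myeWinners D k v ↔ W.card = min k n ∧ ∀ W' : Finset (Fin n), W'.card ≤ k →
      ∑ i ∈ W', D.ironedValue (v i) ≤ ∑ i ∈ W, D.ironedValue (v i) := by
  simp [myeWinners]

theorem myeWinners_of_le {n : ℕ} (D : Prior) {k : ℕ} (hk : n ≤ k) (v : Fin n → ℝ) :
    myeWinners D k v = {Finset.univ} := by
  ext W
  rw [mem_myeWinners, Finset.mem_singleton, min_eq_right hk]
  constructor
  · rintro ⟨h, -⟩
    exact Finset.eq_univ_of_card W (by simpa using h)
  · rintro rfl
    exact ⟨by simp, fun W' _ => Finset.sum_le_sum_of_subset_of_nonneg (Finset.subset_univ _)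
      fun i _ _ => D.ironedValue_nonneg _⟩

theorem mem_priorityWinners {n m : ℕ} {S T W : Finset (Fin n)} (hST : Disjoint S T) :
    W ∈ priorityWinners m S T ↔ W.card = S.card + m ∧ S ⊆ W ∧ W ⊆ S ∪ T := by
  rw [priorityWinners, Finset.mem_image]
  constructor
  · rintro ⟨U, hU, rfl⟩
    rw [Finset.mem_powersetCard] at hU
    exact ⟨by rw [Finset.card_union_of_disjoint (hST.mono_right hU.1), hU.2],
      Finset.subset_union_left, Finset.union_subset_union_right hU.1⟩
  · rintro ⟨h1, h2, h3⟩
    refine ⟨W \ S, Finset.mem_powersetCard.2 ⟨?_, ?_⟩, Finset.union_sdiff_of_subset h2⟩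
    · intro i hi
      rw [Finset.mem_sdiff] at hi
      exact (Finset.mem_union.1 (h3 hi.1)).resolve_left hi.2
    · rw [Finset.card_sdiff_of_subset h2]
      omega

/-- Measured relative to `d`, weights are positive exactly on `S` and zero exactly on `T`, so a
`k`-set is optimal iff it contains `S` and stays inside `S ∪ T`. Nonnegativity of `d` handles
competitors with fewer than `k` agents. -/
theorem myeWinners_eq_priorityWinners {n : ℕ} (D : Prior) {k : ℕ} (v : Fin n → ℝ) {d : ℝ}
    (hd : 0 ≤ d) {S T : Finset (Fin n)} (hS : ∀ i, i ∈ S ↔ d < D.ironedValue (v i))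
    (hT : ∀ i, i ∈ T ↔ D.ironedValue (v i) = d) (h1 : S.card ≤ k) (h2 : k ≤ S.card + T.card) :
    myeWinners D k v = priorityWinners (k - S.card) S T := by
  have hST : Disjoint S T := Finset.disjoint_left.2 fun i hi hi' =>
    absurd ((hT i).1 hi') ((hS i).1 hi).ne'
  have hkn : k ≤ n := by
    have := Finset.card_le_univ (S ∪ T)
    rw [Finset.card_union_of_disjoint hST, Fintype.card_fin] at this
    omega
  set w : Fin n → ℝ := fun i => D.ironedValue (v i) with hw
  have hsum : ∀ W : Finset (Fin n), ∑ i ∈ W, w i = ∑ i ∈ W, (w i - d) + W.card * d := fun W => by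
    rw [Finset.sum_sub_distrib, Finset.sum_const, nsmul_eq_mul]
    ring
  have hsplit : ∀ W : Finset (Fin n), ∑ i ∈ W, (w i - d)
      = ∑ i ∈ S, (w i - d) - ∑ i ∈ S \ W, (w i - d) + ∑ i ∈ W \ S, (w i - d) := fun W => by
    have e1 := Finset.sum_inter_add_sum_sdiff W S fun i => w i - d
    have e2 := Finset.sum_inter_add_sum_sdiff S W fun i => w i - d
    rw [Finset.inter_comm] at e2
    linarith
  have hpos : ∀ W : Finset (Fin n), ∀ i ∈ S \ W, 0 ≤ w i - d := fun W i hi =>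
    sub_nonneg.2 ((hS i).1 (Finset.mem_sdiff.1 hi).1).le
  have hneg : ∀ W : Finset (Fin n), ∀ i ∈ W \ S, w i - d ≤ 0 := fun W i hi =>
    sub_nonpos.2 (not_lt.1 fun h => (Finset.mem_sdiff.1 hi).2 ((hS i).2 h))
  have hprio : ∀ W ∈ priorityWinners (k - S.card) S T,
      W.card = k ∧ ∑ i ∈ W, w i = ∑ i ∈ S, (w i - d) + k * d := by
    intro W hW
    rw [mem_priorityWinners hST] at hW
    have hc : W.card = k := by omega
    refine ⟨hc, ?_⟩
    rw [hsum, hc, hsplit, Finset.sdiff_eq_empty_iff_subset.2 hW.2.1, Finset.sum_empty, sub_zero,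
      Finset.sum_eq_zero (s := W \ S), add_zero]
    intro i hi
    rw [Finset.mem_sdiff] at hi
    exact sub_eq_zero.2 ((hT i).1 ((Finset.mem_union.1 (hW.2.2 hi.1)).resolve_left hi.2))
  ext W
  rw [mem_myeWinners, min_eq_left hkn]
  constructor
  · rintro ⟨hc, hmax⟩
    obtain ⟨W₀, hW₀⟩ := priorityWinners_nonempty (S := S) (show k - S.card ≤ T.card by omega)
    obtain ⟨hc₀, hs₀⟩ := hprio W₀ hW₀
    have hle := hmax W₀ hc₀.le
    change ∑ i ∈ W₀, w i ≤ ∑ i ∈ W, w i at hle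
    rw [hs₀, hsum, hc, hsplit W] at hle
    have n1 := Finset.sum_nonneg (hpos W)
    have n2 := Finset.sum_nonpos (hneg W)
    have z1 : ∑ i ∈ S \ W, (w i - d) = 0 := by linarith
    have z2 : ∑ i ∈ W \ S, (w i - d) = 0 := by linarith
    rw [Finset.sum_eq_zero_iff_of_nonneg (hpos W)] at z1
    rw [Finset.sum_eq_zero_iff_of_nonpos (hneg W)] at z2
    rw [mem_priorityWinners hST]
    refine ⟨by omega, fun i hi => ?_, fun i hi => ?_⟩
    · by_contra hiW
      have := z1 i (Finset.mem_sdiff.2 ⟨hi, hiW⟩)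
      have := (hS i).1 hi
      change d < w i at this
      linarith
    · by_cases hiS : i ∈ S
      · exact Finset.mem_union_left _ hiS
      · exact Finset.mem_union_right _
          ((hT i).2 (sub_eq_zero.1 (z2 i (Finset.mem_sdiff.2 ⟨hi, hiS⟩))))
  · intro hW
    obtain ⟨hc, hs⟩ := hprio W hW
    refine ⟨hc, fun W' hW' => ?_⟩
    change ∑ i ∈ W', w i ≤ ∑ i ∈ W, w i
    rw [hs, hsum, hsplit]
    have n1 := Finset.sum_nonneg (hpos W')
    have n2 := Finset.sum_nonpos (hneg W')
    have n3 : (W'.card : ℝ) * d ≤ k * d :=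
      mul_le_mul_of_nonneg_right (by exact_mod_cast hW') hd
    linarith

/-- Among `n > k` weights there is a weight `d` exceeded by at most `k` weights, while more than
`k` weights are at least `d`. -/
theorem exists_cutoff {n k : ℕ} (hk : k < n) (w : Fin n → ℝ) :
    ∃ j, (Finset.univ.filter fun i => w j < w i).card ≤ k ∧
      k < (Finset.univ.filter fun i => w j < w i).card +
        (Finset.univ.filter fun i => w i = w j).card := by
  have : Nonempty (Fin n) := ⟨⟨0, by omega⟩⟩
  obtain ⟨m, -, hm⟩ := Finset.exists_max_image Finset.univ w Finset.univ_nonempty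
  -- Take the least weight exceeded by at most `k` others. If at most `k` weights were at least as
  -- large, the next smaller weight would also qualify.
  obtain ⟨j, hj, hmin⟩ := Finset.exists_min_image
    (Finset.univ.filter fun j => (Finset.univ.filter fun i => w j < w i).card ≤ k) w
    ⟨m, by
      rw [Finset.mem_filter, Finset.filter_false_of_mem fun i hi => (hm i hi).not_gt]
      simp⟩
  rw [Finset.mem_filter] at hj
  refine ⟨j, hj.2, ?_⟩
  by_contra! hle
  rw [← Finset.card_union_of_disjoint (Finset.disjoint_filter.2 fun i _ h h' => h.ne' h')] at hle
  set U := (Finset.univ.filter fun i => w j < w i) ∪ Finset.univ.filter fun i => w i = w j with hU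
  have hmemU : ∀ i, i ∈ U ↔ w j ≤ w i := fun i => by
    simp [hU, le_iff_lt_or_eq, eq_comm]
  have hne : (Finset.univ \ U).Nonempty := by
    rw [← Finset.card_pos, Finset.card_sdiff_of_subset (Finset.subset_univ _), Finset.card_univ,
      Fintype.card_fin]
    omega
  obtain ⟨l, hl, hlmax⟩ := Finset.exists_max_image _ w hne
  have hlj : w l < w j := by
    rw [Finset.mem_sdiff, hmemU] at hl
    exact not_le.1 hl.2
  have hsub : (Finset.univ.filter fun i => w l < w i) ⊆ U := fun i hi => by
    by_contra h
    exact absurd (hlmax i (Finset.mem_sdiff.2 ⟨Finset.mem_univ _, h⟩))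
      (Finset.mem_filter.1 hi).2.not_ge
  exact absurd (hmin l (Finset.mem_filter.2 ⟨Finset.mem_univ _,
    (Finset.card_le_card hsub).trans hle⟩)) hlj.not_ge

/-! ### The allocation as a function of one bid -/

section Allocation

variable {n k : ℕ} {D : Prior} {v : Fin n → ℝ} {d : ℝ} {S T : Finset (Fin n)}

theorem myeAlloc_update_of_gt (hd : 0 ≤ d) (hS : ∀ i, i ∈ S ↔ d < D.ironedValue (v i))
    (hT : ∀ i, i ∈ T ↔ D.ironedValue (v i) = d) (h1 : S.card ≤ k) (h2 : k < S.card + T.card)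
    {i : Fin n} (hi : i ∈ S) {z : ℝ} (hz : d < D.ironedValue z) :
    myeAlloc D k (Function.update v i z) i = 1 := by
  rw [myeAlloc, myeWinners_eq_priorityWinners D _ hd (S := S) (T := T) _ _ h1 h2.le,
    winProb_priorityWinners_of_mem_left (by omega) hi]
  · intro j
    rcases eq_or_ne j i with rfl | hji
    · simpa [hi] using hz
    · simpa [hji] using hS j
  · intro j
    rcases eq_or_ne j i with rfl | hji
    · have hiT : j ∉ T := fun h => absurd ((hT j).1 h) ((hS j).1 hi).ne'
      simpa [hiT] using hz.ne'
    · simpa [hji] using hT j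

/-- Because `k < S.card + T.card` is strict, at least `k` other agents remain at or above `d`, so
`d` is still a cutoff and excludes `i`. -/
theorem myeAlloc_update_of_lt (hd : 0 ≤ d) (hS : ∀ i, i ∈ S ↔ d < D.ironedValue (v i))
    (hT : ∀ i, i ∈ T ↔ D.ironedValue (v i) = d) (h1 : S.card ≤ k) (h2 : k < S.card + T.card)
    {i : Fin n} {z : ℝ} (hz : D.ironedValue z < d) :
    myeAlloc D k (Function.update v i z) i = 0 := by
  have hST : Disjoint S T := Finset.disjoint_left.2 fun i hi hi' =>
    absurd ((hT i).1 hi') ((hS i).1 hi).ne'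
  have hc : S.card + T.card ≤ (S.erase i).card + (T.erase i).card + 1 := by
    by_cases hi : i ∈ S
    · have hiT : i ∉ T := Finset.disjoint_left.1 hST hi
      rw [Finset.card_erase_of_mem hi, Finset.erase_eq_of_notMem hiT]
      omega
    · rw [Finset.erase_eq_of_notMem hi]
      have := Finset.pred_card_le_card_erase (s := T) (a := i)
      omega
  have hc' : (S.erase i).card ≤ S.card := Finset.card_erase_le
  rw [myeAlloc, myeWinners_eq_priorityWinners D _ hd (S := S.erase i) (T := T.erase i) _ _
    (by omega) (by omega), winProb_priorityWinners_of_notMem (by simp) (by simp)]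
  · intro j
    rcases eq_or_ne j i with rfl | hji
    · simpa using hz.le
    · simpa [hji] using hS j
  · intro j
    rcases eq_or_ne j i with rfl | hji
    · simpa using hz.ne
    · simpa [hji] using hT j

/-- By bidding at the cutoff level, `i` moves from `S` to `T`: `k - (S.card - 1)` units are left for
`T.card + 1` agents. -/
theorem myeAlloc_update_of_eq_of_mem_left (hd : 0 ≤ d)
    (hS : ∀ i, i ∈ S ↔ d < D.ironedValue (v i)) (hT : ∀ i, i ∈ T ↔ D.ironedValue (v i) = d)
    (h1 : S.card ≤ k) (h2 : k < S.card + T.card) {i : Fin n} (hi : i ∈ S) {z : ℝ}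
    (hz : D.ironedValue z = d) :
    myeAlloc D k (Function.update v i z) i = ((k : ℝ) - S.card + 1) / ((T.card : ℝ) + 1) := by
  have hiT : i ∉ T := fun h => absurd ((hT i).1 h) ((hS i).1 hi).ne'
  have hST : Disjoint (S.erase i) (insert i T) := by
    rw [Finset.disjoint_left]
    intro j hj hj'
    rw [Finset.mem_erase] at hj
    exact absurd ((hT j).1 ((Finset.mem_insert.1 hj').resolve_left hj.1)) ((hS j).1 hj.2).ne'
  have hcS : (S.erase i).card = S.card - 1 := Finset.card_erase_of_mem hi
  have hcT : (insert i T).card = T.card + 1 := Finset.card_insert_of_notMem hiT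
  have hS0 : 0 < S.card := Finset.card_pos.2 ⟨i, hi⟩
  rw [myeAlloc, myeWinners_eq_priorityWinners D _ hd (S := S.erase i) (T := insert i T) _ _
    (by omega) (by omega), winProb_priorityWinners_of_mem_right hST (by omega) (by simp), hcT, hcS,
    show k - (S.card - 1) = k + 1 - S.card by omega, Nat.cast_sub (by omega)]
  · push_cast
    ring
  · intro j
    rcases eq_or_ne j i with rfl | hji
    · simpa using hz.le
    · simpa [hji] using hS j
  · intro j
    rcases eq_or_ne j i with rfl | hji
    · simpa using hz
    · simpa [hji] using hT j

theorem myeAlloc_update_of_eq_of_mem_right (hd : 0 ≤ d)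
    (hS : ∀ i, i ∈ S ↔ d < D.ironedValue (v i)) (hT : ∀ i, i ∈ T ↔ D.ironedValue (v i) = d)
    (h1 : S.card ≤ k) (h2 : k < S.card + T.card) {i : Fin n} (hi : i ∈ T) {z : ℝ}
    (hz : D.ironedValue z = d) :
    myeAlloc D k (Function.update v i z) i = ((k - S.card : ℕ) : ℝ) / T.card := by
  have hST : Disjoint S T := Finset.disjoint_left.2 fun i hi hi' =>
    absurd ((hT i).1 hi') ((hS i).1 hi).ne'
  have hiS : i ∉ S := Finset.disjoint_right.1 hST hi
  rw [myeAlloc, myeWinners_eq_priorityWinners D _ hd (S := S) (T := T) _ _ h1 h2.le,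
    winProb_priorityWinners_of_mem_right hST (by omega) hi]
  · intro j
    rcases eq_or_ne j i with rfl | hji
    · simpa [hiS] using hz.le
    · simpa [hji] using hS j
  · intro j
    rcases eq_or_ne j i with rfl | hji
    · simpa [hi] using hz
    · simpa [hji] using hT j

end Allocation

/-! ### Payments -/

/-- The end points are left free since the ironed value exactly at a threshold is not determined. -/
theorem intervalIntegral_of_eq_const {f : ℝ → ℝ} {a b c : ℝ} (hab : a ≤ b)
    (h : ∀ z, a < z → z < b → f z = c) :
    IntervalIntegrable f volume a b ∧ ∫ z in a..b, f z = (b - a) * c := by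
  have hae : ∀ᵐ z ∂volume, z ∈ Set.uIoc a b → f z = c := by
    have hb : ∀ᵐ z ∂(volume : Measure ℝ), z ≠ b := by simp [ae_iff]
    filter_upwards [hb] with z hz hz'
    rw [Set.uIoc_of_le hab] at hz'
    exact h z hz'.1 (lt_of_le_of_ne hz'.2 hz)
  constructor
  · refine (intervalIntegrable_const (c := c)).congr_ae ?_
    rw [Filter.EventuallyEq, ae_restrict_iff' measurableSet_uIoc]
    filter_upwards [hae] with z hz hz'
    exact (hz hz').symm
  · rw [intervalIntegral.integral_congr_ae hae, intervalIntegral.integral_const, smul_eq_mul]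

theorem mye_same_of_le {n k : ℕ} (hk : n ≤ k) (D : Prior) (v : Fin n → ℝ) :
    (mye D k v).Same (twoPriceOn k Finset.univ ∅ 0 0) := by
  have ha : ∀ (u : Fin n → ℝ) (i : Fin n), myeAlloc D k u i = 1 := fun u i => by
    rw [myeAlloc, myeWinners_of_le D hk]
    exact winProb_eq_one (Finset.singleton_nonempty _) (by simp)
  rw [twoPriceOn, if_neg (by simpa using hk), if_pos (by simpa using hk)]
  refine ⟨by simpa [mye] using myeWinners_of_le D hk v, fun W _ i _ => ?_⟩
  simp [mye, myePayment, ha]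

theorem exists_mye_same_of_lt {n k : ℕ} (hk : k < n) (D : Prior) {v : Fin n → ℝ}
    (hv : ∀ i, 0 ≤ v i) :
    ∃ p q : ℝ, 0 ≤ q ∧ q ≤ p ∧ ∃ S T : Finset (Fin n),
      IsSplit v p q S T ∧ (mye D k v).Same (twoPriceOn k S T p q) := by
  obtain ⟨l, h1, h2⟩ := exists_cutoff hk fun i => D.ironedValue (v i)
  set d := D.ironedValue (v l) with hd
  set S := Finset.univ.filter fun i => d < D.ironedValue (v i) with hSdef
  set T := Finset.univ.filter fun i => D.ironedValue (v i) = d with hTdef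
  have hd0 : 0 ≤ d := D.ironedValue_nonneg _
  have hS : ∀ i, i ∈ S ↔ d < D.ironedValue (v i) := fun i => by simp [hSdef]
  have hT : ∀ i, i ∈ T ↔ D.ironedValue (v i) = d := fun i => by simp [hTdef]
  have hST : Disjoint S T := Finset.disjoint_left.2 fun i hi hi' =>
    absurd ((hT i).1 hi') ((hS i).1 hi).ne'
  -- `q` is the least bid level at which the ironed value reaches `d`; below, `p` is the level at
  -- which it starts to exceed `d`.
  set Q : Set ℝ := {z | 0 ≤ z ∧ d ≤ D.ironedValue z} with hQ
  have hlQ : v l ∈ Q := ⟨hv l, le_rfl⟩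
  have hQb : BddBelow Q := ⟨0, fun z hz => hz.1⟩
  set q := sInf Q with hq
  have hq0 : 0 ≤ q := le_csInf ⟨_, hlQ⟩ fun z hz => hz.1
  have hql : q ≤ v l := csInf_le hQb hlQ
  have hlow : ∀ z, 0 ≤ z → z < q → D.ironedValue z < d := fun z hz hzq => by
    by_contra! h
    exact absurd (csInf_le hQb ⟨hz, h⟩) hzq.not_ge
  have hhigh : ∀ z, q < z → d ≤ D.ironedValue z := fun z hz => by
    obtain ⟨y, hy, hyz⟩ := exists_lt_of_csInf_lt ⟨_, hlQ⟩ hz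
    exact hy.2.trans (D.ironedValue_mono hyz.le)
  obtain ⟨p, hlp, hpS, hp1, hp2⟩ : ∃ p, v l ≤ p ∧ (∀ i ∈ S, p ≤ v i) ∧
      (∀ i, p < v i → i ∈ S) ∧ ∀ i ∈ S, (∀ z, 0 ≤ z → z < p → D.ironedValue z ≤ d) ∧
        ∀ z, p < z → d < D.ironedValue z := by
    rcases S.eq_empty_or_nonempty with hS0 | ⟨m, hm⟩
    -- Without priority agents nobody pays `p`, so any bound of the values serves.
    · obtain ⟨B, hB⟩ := (Set.finite_range v).bddAbove
      refine ⟨B, hB ⟨l, rfl⟩, by simp [hS0], fun i hi => absurd (hB ⟨i, rfl⟩) hi.not_ge, ?_⟩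
      simp [hS0]
    · set P : Set ℝ := {z | 0 ≤ z ∧ D.ironedValue z ≤ d} with hP
      have hlP : v l ∈ P := ⟨hv l, le_rfl⟩
      have hub : ∀ i ∈ S, v i ∈ upperBounds P := fun i hi z hz => by
        by_contra! h
        exact absurd (D.ironedValue_mono h.le) (hz.2.trans_lt ((hS i).1 hi)).not_ge
      have hgt : ∀ z, sSup P < z → d < D.ironedValue z := fun z hz => by
        by_contra! h
        have h0 : 0 ≤ z := (hv l).trans ((le_csSup ⟨_, hub m hm⟩ hlP).trans hz.le)
        exact absurd (le_csSup ⟨_, hub m hm⟩ (show z ∈ P from ⟨h0, h⟩)) hz.not_ge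
      refine ⟨sSup P, le_csSup ⟨_, hub m hm⟩ hlP, fun i hi => csSup_le ⟨_, hlP⟩ (hub i hi),
        fun i hi => (hS i).2 (hgt _ hi), fun i hi => ⟨fun z _ hz' => ?_, hgt⟩⟩
      obtain ⟨y, hy, hzy⟩ := exists_lt_of_lt_csSup ⟨_, hlP⟩ hz'
      exact (D.ironedValue_mono hzy.le).trans hy.2
  have hqp : q ≤ p := hql.trans hlp
  have hmemST : ∀ i, i ∈ S ∪ T ↔ d ≤ D.ironedValue (v i) := fun i => by
    rw [Finset.mem_union, hS, hT, le_iff_lt_or_eq, eq_comm (a := d)]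
  refine ⟨p, q, hq0, hqp, S, T, ⟨hST, hp1, hpS, fun i hi => (hmemST i).2 (hhigh _ hi),
    fun i hi => csInf_le hQb ⟨hv i, (hmemST i).1 hi⟩, fun i j hij => by
      rw [hS, hS, hT, hT, hij]; exact ⟨Iff.rfl, Iff.rfl⟩⟩, ?_⟩
  rw [twoPriceOn_of_le_of_lt p q h1 h2]
  have hwin : myeWinners D k v = priorityWinners (k - S.card) S T :=
    myeWinners_eq_priorityWinners D v hd0 hS hT h1 h2.le
  refine ⟨hwin, fun W hW i hi => ?_⟩
  change W ∈ myeWinners D k v at hW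
  rw [hwin, mem_priorityWinners hST] at hW
  -- The allocation to `i` is `0` below `q`. For `i ∈ S` it is the rebate chance between `q` and `p`
  -- and `1` above `p`; for `i ∈ T` it is constant from `q` to `v i`.
  have hlow' := intervalIntegral_of_eq_const (f := fun z => myeAlloc D k (Function.update v i z) i)
    hq0 fun z hz hzq => myeAlloc_update_of_lt hd0 hS hT h1 h2 (hlow z hz.le hzq)
  by_cases hiS : i ∈ S
  · have hmid := intervalIntegral_of_eq_const
      (f := fun z => myeAlloc D k (Function.update v i z) i) hqp fun z hz hzp =>
        myeAlloc_update_of_eq_of_mem_left hd0 hS hT h1 h2 hiS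
          (le_antisymm ((hp2 i hiS).1 z (hq0.trans hz.le) hzp) (hhigh z hz))
    have htop := intervalIntegral_of_eq_const
      (f := fun z => myeAlloc D k (Function.update v i z) i) (hpS i hiS) fun z hz _ =>
        myeAlloc_update_of_gt hd0 hS hT h1 h2 hiS ((hp2 i hiS).2 z hz)
    have hx : myeAlloc D k v i = 1 := by
      rw [myeAlloc, hwin, winProb_priorityWinners_of_mem_left (by omega) hiS]
    simp only [mye, myePayment, if_pos hiS, hx]
    rw [← intervalIntegral.integral_add_adjacent_intervals (hlow'.1.trans hmid.1) htop.1,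
      ← intervalIntegral.integral_add_adjacent_intervals hlow'.1 hmid.1, hlow'.2, hmid.2, htop.2]
    field_simp
    ring
  · have hiT : i ∈ T := (Finset.mem_union.1 (hW.2.2 hi)).resolve_left hiS
    have hmid := intervalIntegral_of_eq_const
      (f := fun z => myeAlloc D k (Function.update v i z) i)
      (csInf_le hQb ⟨hv i, ((hT i).1 hiT).ge⟩) fun z hz hzv =>
        myeAlloc_update_of_eq_of_mem_right hd0 hS hT h1 h2 hiT
          (le_antisymm ((D.ironedValue_mono hzv.le).trans ((hT i).1 hiT).le) (hhigh z hz))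
    have hx : myeAlloc D k v i = ((k - S.card : ℕ) : ℝ) / T.card := by
      rw [myeAlloc, hwin, winProb_priorityWinners_of_mem_right hST (by omega) hiT]
    have hlt : 0 < k - S.card := by
      have : (S ∪ {i}).card ≤ W.card := Finset.card_le_card
        (Finset.union_subset hW.2.1 (Finset.singleton_subset_iff.2 hi))
      rw [Finset.card_union_of_disjoint (Finset.disjoint_singleton_right.2 hiS),
        Finset.card_singleton] at this
      omega
    have hTpos : 0 < T.card := Finset.card_pos.2 ⟨i, hiT⟩
    have hx0 : ((k - S.card : ℕ) : ℝ) / T.card ≠ 0 := by positivity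
    simp only [mye, myePayment, if_neg hiS, hx]
    rw [← intervalIntegral.integral_add_adjacent_intervals hlow'.1 hmid.1, hlow'.2, hmid.2,
      div_eq_iff hx0]
    ring

theorem exists_mye_same {n : ℕ} (k : ℕ) (D : Prior) {v : Fin n → ℝ} (hv : ∀ i, 0 ≤ v i) :
    ∃ p q : ℝ, 0 ≤ q ∧ q ≤ p ∧ ∃ S T : Finset (Fin n),
      IsSplit v p q S T ∧ (mye D k v).Same (twoPriceOn k S T p q) := by
  rcases le_or_gt n k with hk | hk
  · refine ⟨0, 0, le_rfl, le_rfl, Finset.univ, ∅, ⟨by simp, by simp, fun i _ => hv i, by simp,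
      fun i _ => hv i, by simp⟩, mye_same_of_le hk D v⟩
  · exact exists_mye_same_of_lt hk D hv

end

end MoneyBurning

/-! ### Assembly of the theorem. -/

open MoneyBurning in
theorem mainTheorem6 (n k : ℕ) (v : Fin n → ℝ) (hv : ∀ i, 0 ≤ v i) :
    -- each optimal mechanism coincides ex post with a two-price lottery
    (∀ D : MoneyBurning.Prior, ∃ p q : ℝ, 0 ≤ q ∧ q ≤ p ∧ ∃ S T : Finset (Fin n),
      MoneyBurning.IsSplit v p q S T ∧
      (MoneyBurning.mye D k v).Same (MoneyBurning.twoPriceOn k S T p q)) ∧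
    -- the benchmark is a genuine supremum, and is the surplus of some `(p,q)`-lottery
    IsLUB (Set.range fun D : MoneyBurning.Prior => (MoneyBurning.mye D k v).surplus v)
      (MoneyBurning.benchmark k v) ∧
    (∃ p q : ℝ, 0 ≤ q ∧ q ≤ p ∧
      (MoneyBurning.pqLottery k p q v).surplus v = MoneyBurning.benchmark k v) ∧
    -- comparison of the `(p,q)`-lottery with single-price lotteries
    (∀ p q : ℝ, 0 ≤ q → q ≤ p →
      (MoneyBurning.pqLottery k p q v).surplus v ≤
        (MoneyBurning.pqLottery k p p v).surplus v +
          (MoneyBurning.pqLottery k q q v).surplus v) ∧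
    (∀ p q : ℝ, 0 ≤ q → q ≤ p → (∀ i, v i ≠ p ∧ v i ≠ q) →
      (MoneyBurning.pqLottery k p q v).surplus v ≤
        (MoneyBurning.pLottery k p v).surplus v + (MoneyBurning.pLottery k q v).surplus v) ∧
    (∀ p q : ℝ, 0 ≤ q → q ≤ p → ∃ p' : ℝ, 0 ≤ p' ∧
      (MoneyBurning.pqLottery k p q v).surplus v / 2 ≤
        (MoneyBurning.pLottery k p' v).surplus v) ∧
    -- some single-price lottery obtains half of the benchmark
    (∃ p : ℝ, 0 ≤ p ∧
      MoneyBurning.benchmark k v / 2 ≤ (MoneyBurning.pLottery k p v).surplus v) := by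
  obtain ⟨P, Q, hQ0, hQP, hmax⟩ := exists_pqSurplus_isMax k hv
  have hbound : ∀ D : Prior, 0 ≤ (mye D k v).surplus v ∧
      (mye D k v).surplus v ≤ pqSurplus k v P Q := by
    intro D
    obtain ⟨p, q, hq, hqp, S, T, hsplit, hsame⟩ := exists_mye_same k D hv
    rw [hsame.surplus_eq v, twoPriceOn_surplus k hsplit.disjoint]
    exact ⟨hsplit.splitSurplus_nonneg k hqp,
      (hsplit.splitSurplus_le k hqp).trans (hmax p q hq hqp)⟩
  have hlub : IsLUB (Set.range fun D : Prior => (mye D k v).surplus v) (benchmark k v) :=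
    isLUB_ciSup ⟨pqSurplus k v P Q, by rintro _ ⟨D, rfl⟩; exact (hbound D).2⟩
  have h0 : 0 ≤ benchmark k v := by
    obtain ⟨D⟩ := (inferInstance : Nonempty Prior)
    exact (hbound D).1.trans (hlub.1 ⟨D, rfl⟩)
  have h1 : benchmark k v ≤ pqSurplus k v P Q :=
    hlub.2 (by rintro _ ⟨D, rfl⟩; exact (hbound D).2)
  -- The benchmark need not be compared further with the maximum: every level in between is the
  -- surplus of some `(p,q)`-lottery.
  obtain ⟨p, q, hq, hqp, hpq⟩ := exists_pqSurplus_eq k v hQ0 hQP h0 h1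
  refine ⟨fun D => exists_mye_same k D hv, hlub, ⟨p, q, hq, hqp, ?_⟩, ?_, ?_, ?_, ?_⟩
  · rw [pqLottery_surplus, hpq]
  · intro p q _ hqp
    simp only [pqLottery_surplus]
    exact pqSurplus_le_add k v hqp
  · intro p q _ hqp hne
    rw [pqLottery_surplus, pLottery_surplus_of_ne k fun i => (hne i).1,
      pLottery_surplus_of_ne k fun i => (hne i).2]
    exact pqSurplus_le_add k v hqp
  · intro p q hq hqp
    rw [pqLottery_surplus]
    exact exists_pLottery_ge_half k v hq hqp
  · rw [← hpq]
    exact exists_pLottery_ge_half k v hq hqp
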